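/- For $x\in\mathbb R$ write $\mathrm e(x)=\exp(2\pi i x)$ and let $\|x\|$ be the distance from $x$ to the nearest integer. Let $\tau_r(n)$ be the number of ordered factorisations $n=d_1\cdots d_r$ of $n$ into $r$ positive integers. For every integer $k\ge 1$ there are constants $C=C(k)>0$ and $K=K(k)>0$ such that the following holds. Let $N\ge 2$ be an integer, let $\delta\in(0,1/2)$, let $M\ge 2$ be real, put $L=N/M$, and let $H$ be a real number with $$\delta^{-C}\max(L,M)\le H\le N .$$ Let $(a_\ell)_{\ell\ge1}$ and $(b_m)_{m\ge1}$ be complex numbers with $|a_\ell|\le\tau_5(\ell)$ and $|b_m|\le\tau_3(m)$ for all $\ell,m\geq 1$. Let $\alpha_1,\dots,\alpha_k\in\mathbb R$, put $\alpha_{k+1}=0$, and let $$g(n)=\sum_{j=1}^k\alpha_j(n-N)^j .$$ If $$\Bigl|\sum_{\substack{\ell,m\ge 1\\ M<m\le 2M\\ N<\ell m\le N+H}}a_\ell b_m\,\mathrm e(g(\ell m))\Bigr|\ \ge\ \delta H(\log N)^{32},$$ then there is a positive integer $q\le\delta^{-K}$ such that $$\bigl\|q\bigl(j\alpha_j+(j+1)N\alpha_{j+1}\bigr)\bigr\|\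 \le\ \delta^{-K}\,\frac{N}{H^{j+1}}\qquad\text{for all }1\le j\le k .$$ -/

import Mathlib

namespace ShortIntervalTypeII

/-- The `r`-fold divisor function `τ_r(n)`: the number of ordered factorisations
`n = d₁ ⋯ d_r` into positive integers (for `n ≥ 1`). -/
def tau (r n : ℕ) : ℕ := (Nat.finMulAntidiag r n).card

/-- `e(x) = exp(2πix)`. -/
noncomputable def e (x : ℝ) : ℂ := Complex.exp (2 * Real.pi * Complex.I * x)

/-- `‖x‖`, the distance from the real number `x` to the nearest integer. -/
noncomputable def distInt (x : ℝ) : ℝ := |x - round x|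

/-- The polynomial `g(x) = ∑_{j=1}^k α_j (x - N)^j`. -/
noncomputable def g (k N : ℕ) (α : ℕ → ℝ) (x : ℝ) : ℝ :=
  ∑ j ∈ Finset.Icc 1 k, α j * (x - N) ^ j

open Classical in
/-- The pairs `(ℓ, m)` of positive integers with `M < m ≤ 2M` and `N < ℓm ≤ N + H`; the box
only serves to make the set visibly finite, see `mem_pairs`. -/
noncomputable def pairs (N : ℕ) (H M : ℝ) : Finset (ℕ × ℕ) :=
  (Finset.range (⌊(N : ℝ) + H⌋₊ + 1) ×ˢ Finset.range (⌊(N : ℝ) + H⌋₊ + 1)).filter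
    fun p => (M < p.2 ∧ (p.2 : ℝ) ≤ 2 * M) ∧
      ((N : ℝ) < p.1 * p.2 ∧ (p.1 : ℝ) * p.2 ≤ N + H)

theorem mem_pairs {N : ℕ} {H M : ℝ} {p : ℕ × ℕ} :
    p ∈ pairs N H M ↔ (M < p.2 ∧ (p.2 : ℝ) ≤ 2 * M) ∧
      ((N : ℝ) < p.1 * p.2 ∧ (p.1 : ℝ) * p.2 ≤ N + H) := by
  simp only [pairs, Finset.mem_filter, Finset.mem_product, Finset.mem_range, Nat.lt_succ_iff,
    and_iff_right_iff_imp]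
  rintro ⟨-, h1, h2⟩
  have hpos : 0 < p.1 * p.2 := by
    have : (N : ℝ) < ((p.1 * p.2 : ℕ) : ℝ) := by push_cast; exact h1
    exact lt_of_le_of_lt (Nat.zero_le N) (by exact_mod_cast this)
  have hle : p.1 * p.2 ≤ ⌊(N : ℝ) + H⌋₊ := Nat.le_floor (by push_cast; exact h2)
  exact ⟨(Nat.le_mul_of_pos_right _ (Nat.pos_of_mul_pos_left hpos)).trans hle,
    (Nat.le_mul_of_pos_left _ (Nat.pos_of_mul_pos_right hpos)).trans hle⟩

end ShortIntervalTypeII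

namespace ShortIntervalTypeII

/-! ### Distance to the nearest integer and additive characters -/

/-! Put `X = 1/δ ≥ 2`. Every loss below is a fixed power of `X`, and the hypothesis on `H` makes
both `H/M` and `HM/N` at least a large power of `X`.

Two applications of Cauchy–Schwarz remove the coefficients `a` and `b`. The divisor moments cost
`2·24 + 80 = 4·32` logarithms in the fourth power of the sum, which is what the factor `(log N)^32`
pays for. What remains is `exists_large_correlations`: for many `m ∈ (M, 2M]` there are many `m'`
with `|m' - m| ≤ 2HM/N` such that the sum of `e(g(lm) - g(lm'))` over `l` is within a power of `X`
of its trivial bound `H/M`.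

Fix such an `m`, put `l = l₀ + t` with `l₀ = ⌊N/m⌋`, and let `p(x - N) = g(x)`. The phase is a
polynomial in `t` whose `j`-th coefficient is `F_j(0) - F_j(m' - m)`, where `F_j(s) = (m+s)^j
p⁽ʲ⁾(l₀(m+s) - N)/j!`. By `weyl_inequality` a bounded multiple of it lies within about `(M/H)^j` of
an integer. For fixed `j` it is also a polynomial in `m' - m`, so `vinogradov_polynomial`, at the
scale `HM/N`, controls its linear coefficient `-F_j'(0)`. By the product rule
(`coeff_one_bilinear`), `F_j'(0) = m^(j-1) D⁽ʲ⁾(u)/j!` with `u = l₀m - N` and `D` the polynomial `x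
g'(x)` in the variable `x - N`. The coefficients of `D` are exactly `jα_j + (j+1)Nα_{j+1}`.

Since `|u| ≤ H`, going down from the top degree lets the higher coefficients of `D` be subtracted.
This leaves `m^(j-1) D_j` close to rationals for many `m`, and Vinogradov's lemma for the monomial
`m^(j-1)` strips that factor, with final error about `N/H^(j+1)` (`coeff_of_taylor_coeff_mul_pow`).

The Weyl and Vinogradov lemmas are both proved by differencing `P(x+h) - P(x)` and induction on the
degree. Both recover the coefficients of degree at least two through `coeff_of_taylor_sub`, and
treat the linear coefficient separately. -/

theorem distInt_eq_norm (x : ℝ) : distInt x = ‖(x : UnitAddCircle)‖ :=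
  (UnitAddCircle.norm_eq).symm

theorem distInt_nonneg (x : ℝ) : 0 ≤ distInt x := abs_nonneg _

theorem distInt_le_half (x : ℝ) : distInt x ≤ 1 / 2 := abs_sub_round x

theorem distInt_add_le (x y : ℝ) : distInt (x + y) ≤ distInt x + distInt y := by
  simp only [distInt_eq_norm, AddCircle.coe_add]
  exact norm_add_le _ _

theorem distInt_sub_le (x y : ℝ) : distInt (x - y) ≤ distInt x + distInt y := by
  simp only [distInt_eq_norm, AddCircle.coe_sub]
  exact norm_sub_le _ _

theorem distInt_int_mul_le (n : ℤ) (x : ℝ) : distInt (n * x) ≤ |(n : ℝ)| * distInt x := by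
  rw [distInt_eq_norm, distInt_eq_norm, ← zsmul_eq_mul, AddCircle.coe_zsmul]
  simpa [Int.norm_eq_abs] using norm_zsmul_le n (x : UnitAddCircle)

theorem distInt_nat_mul_le (n : ℕ) (x : ℝ) : distInt (n * x) ≤ n * distInt x := by
  simpa using distInt_int_mul_le n x

theorem distInt_sum_le {ι : Type*} (s : Finset ι) (f : ι → ℝ) :
    distInt (∑ i ∈ s, f i) ≤ ∑ i ∈ s, distInt (f i) := by
  classical
  induction s using Finset.induction_on with
  | empty => simp [distInt]
  | insert a s ha ih =>
    rw [Finset.sum_insert ha, Finset.sum_insert ha]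
    exact (distInt_add_le _ _).trans (by gcongr)

theorem distInt_sub_int (x : ℝ) (n : ℤ) : distInt (x - n) = distInt x := by
  simp [distInt]

theorem distInt_eq_abs {x : ℝ} (hx : |x| ≤ 1 / 2) : distInt x = |x| := by
  rw [distInt_eq_norm, AddCircle.norm_coe_eq_abs_iff 1 one_ne_zero]
  simpa using hx

@[simp] theorem distInt_zero : distInt 0 = 0 := by simp [distInt]

theorem e_add (x y : ℝ) : e (x + y) = e x * e y := by
  simp only [e, ← Complex.exp_add]; congr 1; push_cast; ring

theorem e_int (n : ℤ) : e n = 1 := by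
  rw [e, Complex.exp_eq_one_iff]; exact ⟨n, by push_cast; ring⟩

theorem e_eq_exp_ofReal (x : ℝ) : e x = Complex.exp ((2 * Real.pi * x : ℝ) * Complex.I) := by
  rw [e]; congr 1; push_cast; ring

@[simp] theorem norm_e (x : ℝ) : ‖e x‖ = 1 := by
  rw [e_eq_exp_ofReal, Complex.norm_exp_ofReal_mul_I]

@[simp] theorem e_zero : e 0 = 1 := by simp [e]

theorem e_neg (x : ℝ) : e (-x) = (starRingEnd ℂ) (e x) := by
  rw [e_eq_exp_ofReal, e_eq_exp_ofReal, ← Complex.exp_conj]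
  congr 1; simp [-Complex.ofReal_mul, -neg_mul]; ring

theorem e_sub (x y : ℝ) : e (x - y) = e x * (starRingEnd ℂ) (e y) := by
  rw [sub_eq_add_neg, e_add, e_neg]

theorem e_sub_round (x : ℝ) : e (x - round x) = e x := by
  rw [e_sub, e_int]; simp

theorem norm_e_sub_one (x : ℝ) : ‖e x - 1‖ = 2 * |Real.sin (Real.pi * x)| := by
  have := Complex.norm_exp_I_mul_ofReal_sub_one (2 * Real.pi * x)
  rw [e_eq_exp_ofReal, mul_comm _ Complex.I, this, norm_mul]
  congr 1
  · simp
  · rw [Real.norm_eq_abs]; congr 2; ring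

theorem norm_e_sub_one_le (x : ℝ) : ‖e x - 1‖ ≤ 7 * distInt x := by
  rw [← e_sub_round, norm_e_sub_one]
  have h1 := Real.abs_sin_le_abs (x := Real.pi * (x - round x))
  rw [abs_mul, abs_of_pos Real.pi_pos] at h1
  have h2 : Real.pi * |x - round x| ≤ 3.5 * |x - round x| := by
    gcongr; linarith [Real.pi_lt_d2]
  rw [distInt]; linarith

theorem norm_e_sub_e_le (x y : ℝ) : ‖e x - e y‖ ≤ 7 * distInt (x - y) := by
  have : e x - e y = e y * (e (x - y) - 1) := by
    rw [mul_sub, ← e_add]; simp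
  rw [this, norm_mul, norm_e, one_mul]
  exact norm_e_sub_one_le _

/-- Jordan's inequality `sin t ≥ 2t/π` on `[0, π/2]`. It supplies the denominator in the bound for
geometric sums. -/
theorem distInt_le_norm_e_sub_one (x : ℝ) : 4 * distInt x ≤ ‖e x - 1‖ := by
  rw [← e_sub_round, norm_e_sub_one, distInt]
  have h0 := abs_sub_round x
  set y := x - round x
  have h1 : Real.sin (Real.pi * |y|) ≤ |Real.sin (Real.pi * y)| := by
    rcases abs_cases y with ⟨h, -⟩ | ⟨h, -⟩ <;> rw [h]
    · exact le_abs_self _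
    · rw [mul_neg, Real.sin_neg]; exact neg_le_abs _
  have h2 : 2 / Real.pi * (Real.pi * |y|) ≤ Real.sin (Real.pi * |y|) :=
    Real.mul_le_sin (by positivity) (by
      have := Real.pi_pos
      nlinarith)
  have h3 : 2 / Real.pi * (Real.pi * |y|) = 2 * |y| := by
    field_simp
  linarith

/-- The geometric sum over an interval of integers. -/
theorem norm_geom_sum_e_le (θ : ℝ) (a : ℤ) (n : ℕ) :
    2 * distInt θ * ‖∑ i ∈ Finset.range n, e (θ * (a + i))‖ ≤ 1 := by
  have key : (e θ - 1) * ∑ i ∈ Finset.range n, e (θ * (a + i)) =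
      e (θ * (a + n)) - e (θ * a) := by
    have : ∀ i : ℕ, (e θ - 1) * e (θ * (a + i)) =
        e (θ * (a + (i + 1 : ℕ))) - e (θ * (a + i)) := by
      intro i
      rw [sub_mul, one_mul, ← e_add]; congr 2; push_cast; ring
    rw [Finset.mul_sum, Finset.sum_congr rfl fun i _ => this i,
      Finset.sum_range_sub (fun i : ℕ => e (θ * (a + i)))]
    simp
  have h1 : ‖(e θ - 1) * ∑ i ∈ Finset.range n, e (θ * (a + i))‖ ≤ 2 := by
    rw [key]
    exact (norm_sub_le _ _).trans (by simp; norm_num)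
  rw [norm_mul] at h1
  have h2 := mul_le_mul_of_nonneg_right (distInt_le_norm_e_sub_one θ)
    (norm_nonneg (∑ i ∈ Finset.range n, e (θ * (a + i))))
  linarith

/-! ### Pigeonhole principles -/

theorem exists_card_le_card_mul_card_fiber {ι κ : Type*} [DecidableEq κ] (s : Finset ι)
    (t : Finset κ) (f : ι → κ) (hf : ∀ i ∈ s, f i ∈ t) (ht : t.Nonempty) :
    ∃ y ∈ t, (s.card : ℝ) ≤ t.card * (s.filter fun i => f i = y).card := by
  have h0 : (0 : ℝ) < t.card := by exact_mod_cast ht.card_pos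
  obtain ⟨y, hy, h⟩ := Finset.exists_le_card_fiber_of_nsmul_le_card_of_maps_to
    (b := (s.card : ℝ) / t.card) hf ht (by rw [nsmul_eq_mul]; field_simp; rfl)
  exact ⟨y, hy, by rwa [div_le_iff₀' h0] at h⟩

/-- If bounded nonnegative numbers have a large average then many of them are large. -/
theorem card_le_mul_card_popular {ι : Type*} (s : Finset ι) (f : ι → ℝ) {B Y : ℝ}
    (hB : 0 < B) (hY : 0 < Y) (hf : ∀ i ∈ s, f i ≤ B)
    (h : s.card * B ≤ Y * ∑ i ∈ s, f i) :
    (s.card : ℝ) ≤ 2 * Y * (s.filter fun i => B ≤ 2 * Y * f i).card := by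
  classical
  have h1 : ∑ i ∈ s, f i ≤ (s.filter fun i => B ≤ 2 * Y * f i).card * B +
      s.card * (B / (2 * Y)) := by
    rw [← Finset.sum_filter_add_sum_filter_not s (fun i => B ≤ 2 * Y * f i)]
    refine add_le_add ?_ ?_
    · rw [← nsmul_eq_mul]
      exact Finset.sum_le_card_nsmul _ _ _ fun i hi => hf i (Finset.mem_filter.1 hi).1
    · calc _ ≤ ((s.filter fun i => ¬ B ≤ 2 * Y * f i).card : ℝ) * (B / (2 * Y)) := by
            rw [← nsmul_eq_mul]
            refine Finset.sum_le_card_nsmul _ _ _ fun i hi => ?_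
            rw [le_div_iff₀ (by positivity)]
            have := (Finset.mem_filter.1 hi).2
            linarith
        _ ≤ _ := by
            gcongr
            exact Finset.filter_subset _ _
  have h2 : s.card * B ≤ 2 * Y * (s.filter fun i => B ≤ 2 * Y * f i).card * B := by
    have h3 := mul_le_mul_of_nonneg_left h1 hY.le
    have h4 : Y * (s.card * (B / (2 * Y))) = s.card * B / 2 := by field_simp
    nlinarith
  exact le_of_mul_le_mul_right h2 hB

/-- Pigeonhole over the blocks of length `R` that meet `[-S, S]`: they are numbered from `-n-1` to
`n` with `n = ⌊S⌋ / R`, and `(2n+2)R ≤ 4S` because `R ≤ S`. -/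
theorem exists_block {S : ℝ} {R : ℕ} (hR : 1 ≤ R) (hRS : (R : ℝ) ≤ S) (A : Finset ℤ)
    (hA : ∀ h ∈ A, |(h : ℝ)| ≤ S) :
    ∃ a : ℤ, (A.card : ℝ) * R ≤ 4 * S * (A.filter fun h => h / (R : ℤ) = a).card := by
  have hR0 : (0 : ℤ) < R := by exact_mod_cast hR
  set n : ℤ := ⌊S⌋ / R
  have hS : (1 : ℝ) ≤ S := le_trans (by exact_mod_cast hR) hRS
  have hn : 0 ≤ n := Int.ediv_nonneg (Int.floor_nonneg.2 (by linarith)) hR0.le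
  obtain ⟨a, -, ha⟩ := exists_card_le_card_mul_card_fiber A (Finset.Icc (-n - 1) n)
    (fun h => h / (R : ℤ)) (by
      intro h hh
      have h1 := abs_le.1 (hA h hh)
      have h2 : h ≤ ⌊S⌋ := Int.le_floor.2 h1.2
      have h3 : -⌊S⌋ ≤ h := by
        have : -h ≤ ⌊S⌋ := Int.le_floor.2 (by push_cast; linarith)
        linarith
      rw [Finset.mem_Icc]
      refine ⟨?_, Int.ediv_le_ediv hR0 h2⟩
      rw [Int.le_ediv_iff_mul_le hR0]
      have := Int.lt_ediv_add_one_mul_self ⌊S⌋ hR0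
      have e1 : (-n - 1) * (R : ℤ) = -((n + 1) * R) := by ring
      rw [e1]; linarith)
    ⟨n, by rw [Finset.mem_Icc]; omega⟩
  refine ⟨a, ?_⟩
  have hc : (((Finset.Icc (-n - 1) n).card : ℕ) : ℝ) * R ≤ 4 * S := by
    have h1 : ((Finset.Icc (-n - 1) n).card : ℤ) = 2 * n + 2 := by
      rw [Int.card_Icc]; rw [Int.toNat_of_nonneg (by omega)]; ring
    have h2 : (((Finset.Icc (-n - 1) n).card : ℕ) : ℝ) = 2 * n + 2 := by exact_mod_cast h1
    have h3 : (n : ℝ) * R ≤ S := by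
      have : n * R ≤ ⌊S⌋ := Int.ediv_mul_le _ hR0.ne'
      calc (n : ℝ) * R = ((n * R : ℤ) : ℝ) := by push_cast; rfl
        _ ≤ (⌊S⌋ : ℝ) := by exact_mod_cast this
        _ ≤ S := Int.floor_le S
    rw [h2]; nlinarith
  calc (A.card : ℝ) * R ≤ ((Finset.Icc (-n - 1) n).card * (A.filter fun h => h / (R : ℤ) = a).card) * R := by
        gcongr
    _ = ((Finset.Icc (-n - 1) n).card * R) * (A.filter fun h => h / (R : ℤ) = a).card := by ring
    _ ≤ _ := by gcongr

theorem abs_sub_lt_of_ediv_eq {R : ℕ} (hR : 1 ≤ R) {h h' a : ℤ} (h1 : h / (R : ℤ) = a)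
    (h2 : h' / (R : ℤ) = a) : h - h' < R := by
  have hR0 : (0 : ℤ) < R := by exact_mod_cast hR
  have e1 := Int.mul_ediv_add_emod h R
  have e2 := Int.mul_ediv_add_emod h' R
  have l1 := Int.emod_lt_of_pos h hR0
  have l2 := Int.emod_nonneg h' hR0.ne'
  rw [h1] at e1; rw [h2] at e2
  linarith

/-- A set of integers in a single residue class has two elements far apart. -/
theorem exists_sub_eq_mul {q : ℕ} (hq : 1 ≤ q) {r : ℤ} (B : Finset ℤ) (hB : B.Nonempty)
    (hr : ∀ h ∈ B, h % (q : ℤ) = r) :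
    ∃ h ∈ B, ∃ h' ∈ B, ∃ y : ℕ, h - h' = q * y ∧ B.card ≤ y + 1 := by
  have hq0 : (0 : ℤ) < q := by exact_mod_cast hq
  have key : ∀ h ∈ B, B.min' hB + q * ((h - B.min' hB) / q).toNat = h := by
    intro h hh
    have h1 : (q : ℤ) ∣ h - B.min' hB :=
      Int.ModEq.dvd ((hr _ (B.min'_mem hB)).trans (hr h hh).symm)
    have h2 : 0 ≤ (h - B.min' hB) / q :=
      Int.ediv_nonneg (sub_nonneg.2 (B.min'_le h hh)) hq0.le
    rw [Int.toNat_of_nonneg h2, Int.mul_ediv_cancel' h1]; ring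
  refine ⟨B.max' hB, B.max'_mem hB, B.min' hB, B.min'_mem hB,
    ((B.max' hB - B.min' hB) / q).toNat, ?_, ?_⟩
  · have := key _ (B.max'_mem hB); linarith
  · set y := ((B.max' hB - B.min' hB) / q).toNat
    have : B ⊆ (Finset.range (y + 1)).image fun i : ℕ => B.min' hB + (q : ℤ) * i := by
      intro h hh
      rw [Finset.mem_image]
      refine ⟨((h - B.min' hB) / q).toNat, ?_, key h hh⟩
      rw [Finset.mem_range, Nat.lt_succ_iff]
      apply Int.toNat_le_toNat
      apply Int.ediv_le_ediv hq0
      linarith [B.le_max' h hh]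
    calc B.card ≤ _ := Finset.card_le_card this
      _ ≤ _ := Finset.card_image_le
      _ = y + 1 := Finset.card_range _

/-! ### Linear phases that are often close to integers -/

/-- Vinogradov's lemma for linear phases. -/
theorem vinogradov_linear {X S ε θ : ℝ} (hX : 2 ≤ X) (hS : X ^ 13 ≤ S)
    (hε : ε * X ^ 15 ≤ 1) (A : Finset ℤ) (hA : ∀ h ∈ A, |(h : ℝ)| ≤ S)
    (hcard : S ≤ X * A.card) (hθ : ∀ h ∈ A, distInt (θ * h) ≤ ε) :
    ∃ q : ℕ, 1 ≤ q ∧ (q : ℝ) ≤ X ^ 5 ∧ distInt (q * θ) ≤ X ^ 11 * ε / S := by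
  have hX0 : 0 < X := by linarith
  have hS0 : 0 < S := lt_of_lt_of_le (by positivity) hS
  have h16 : (16 : ℝ) ≤ X ^ 4 := by
    calc (16 : ℝ) = 2 ^ 4 := by norm_num
      _ ≤ X ^ 4 := by gcongr
  have hle : ∀ {i j : ℕ}, i ≤ j → X ^ i ≤ X ^ j := fun h =>
    pow_le_pow_right₀ (by linarith) h
  have hdiff : ∀ h ∈ A, ∀ h' ∈ A, distInt (((h - h' : ℤ) : ℝ) * θ) ≤ 2 * ε := by
    intro h hh h' hh'
    have := distInt_sub_le (θ * h) (θ * h')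
    have e1 : ((h - h' : ℤ) : ℝ) * θ = θ * h - θ * h' := by push_cast; ring
    rw [e1]; linarith [hθ h hh, hθ h' hh']
  -- First stage: a block of length `R` with `R ≥ 8X` can be chosen with at least `R/(4X) ≥ 2`
  -- elements of `A`, and the difference of two of them serves as `q`. This only gives `‖qθ‖ ≤ 2ε`;
  -- the gain of `1/S` comes afterwards.
  obtain ⟨q, hq1, hq5, hq⟩ : ∃ q : ℕ, 1 ≤ q ∧ (q : ℝ) ≤ X ^ 5 ∧ distInt (q * θ) ≤ 2 * ε := by
    set R := ⌈8 * X⌉₊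
    have hR8 : 8 * X ≤ R := Nat.le_ceil _
    have hR9 : (R : ℝ) ≤ X ^ 5 := by
      have := Nat.ceil_lt_add_one (a := 8 * X) (by positivity)
      have : (R : ℝ) < 8 * X + 1 := this
      have e5 : X ^ 5 = X ^ 4 * X := by ring
      nlinarith
    have hR1 : 1 ≤ R := by
      have : (0 : ℝ) < R := by linarith
      exact_mod_cast this
    obtain ⟨a, ha⟩ := exists_block hR1 (hR9.trans ((hle (by norm_num)).trans hS)) A hA
    have h2 : 1 < (A.filter fun h => h / (R : ℤ) = a).card := by
      have h3 : S * R ≤ X * (4 * S * (A.filter fun h => h / (R : ℤ) = a).card) := by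
        calc S * R ≤ X * A.card * R := by gcongr
          _ = X * (A.card * R) := by ring
          _ ≤ _ := by gcongr
      have h4 : S * (8 * X) ≤ S * R := by gcongr
      have h5 : (2 : ℝ) * (4 * S * X) ≤ (A.filter fun h => h / (R : ℤ) = a).card * (4 * S * X) := by
        linarith
      have := le_of_mul_le_mul_right h5 (by positivity)
      have : 2 ≤ (A.filter fun h => h / (R : ℤ) = a).card := by exact_mod_cast this
      omega
    obtain ⟨h, hh, h', hh', hne⟩ := Finset.one_lt_card.1 h2
    wlog hlt : h' < h generalizing h h'
    · exact this h' hh' h hh hne.symm (lt_of_le_of_ne (not_lt.1 hlt) hne)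
    rw [Finset.mem_filter] at hh hh'
    have h5 := abs_sub_lt_of_ediv_eq hR1 hh.2 hh'.2
    refine ⟨(h - h').toNat, by omega, ?_, ?_⟩
    · refine le_trans ?_ hR9
      exact_mod_cast (show (h - h').toNat ≤ R by omega)
    · have := hdiff h hh.1 h' hh'.1
      rwa [← Int.toNat_of_nonneg (show 0 ≤ h - h' by omega), Int.cast_natCast] at this
  refine ⟨q, hq1, hq5, ?_⟩
  have hε0 : 0 ≤ ε := by linarith [distInt_nonneg (q * θ)]
  rcases (distInt_nonneg (q * θ)).eq_or_lt with h0 | hψ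
  · rw [← h0]; positivity
  set ψ := distInt (q * θ) with hψdef
  -- For `y ≤ Y` there is no wrap-around: `yψ ≤ 1/2`, hence `‖y q θ‖ = yψ`. The first stage
  -- guarantees that `Y` is still large.
  set Y := min S (1 / (2 * ψ))
  have hYS : Y ≤ S := min_le_left _ _
  have hYψ : Y * ψ ≤ 1 / 2 := by
    calc Y * ψ ≤ 1 / (2 * ψ) * ψ := by gcongr; exact min_le_right _ _
      _ = 1 / 2 := by field_simp
  have hY : X ^ 13 ≤ Y := by
    refine le_min hS ?_
    rw [le_div_iff₀ (by positivity)]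
    have h4 : (4 : ℝ) ≤ X ^ 2 := by nlinarith
    have h5 : X ^ 13 * (2 * ψ) ≤ X ^ 13 * (4 * ε) := mul_le_mul_of_nonneg_left (by linarith) (by positivity)
    have h6 : X ^ 13 * (4 * ε) ≤ X ^ 13 * (X ^ 2 * ε) := by gcongr
    have e1 : X ^ 13 * (X ^ 2 * ε) = ε * X ^ 15 := by ring
    linarith
  have hY1 : 1 ≤ Y := le_trans (one_le_pow₀ (by linarith)) hY
  set R := ⌊Y⌋₊
  have hRY : (R : ℝ) ≤ Y := Nat.floor_le (by linarith)
  have hR2 : Y ≤ 2 * R := by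
    have h1 := Nat.lt_floor_add_one Y
    have h2 : (1 : ℝ) ≤ R := by exact_mod_cast Nat.le_floor (by simpa using hY1)
    have h3 : Y < R + 1 := h1
    linarith
  have hR1 : 1 ≤ R := Nat.le_floor (by simpa using hY1)
  obtain ⟨a, ha⟩ := exists_block hR1 (hRY.trans hYS) A hA
  set B := A.filter fun h => h / (R : ℤ) = a
  have hB : (R : ℝ) ≤ 4 * X * B.card := by
    have h3 : S * R ≤ S * (4 * X * B.card) := by
      calc S * R ≤ X * A.card * R := by gcongr
        _ = X * (A.card * R) := by ring
        _ ≤ X * (4 * S * B.card) := by gcongr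
        _ = _ := by ring
    exact le_of_mul_le_mul_left h3 hS0
  have hq0 : (0 : ℤ) < q := by exact_mod_cast hq1
  obtain ⟨r, -, hr⟩ := exists_card_le_card_mul_card_fiber B (Finset.Ico (0 : ℤ) q)
    (fun h => h % (q : ℤ)) (fun h _ => by
      rw [Finset.mem_Ico]
      exact ⟨Int.emod_nonneg _ hq0.ne', Int.emod_lt_of_pos _ hq0⟩)
    ⟨0, by rw [Finset.mem_Ico]; omega⟩
  simp only [Int.card_Ico, sub_zero, Int.toNat_natCast] at hr
  set D := B.filter fun h => h % (q : ℤ) = r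
  have hD : (R : ℝ) ≤ 4 * X * q * D.card := by
    calc (R : ℝ) ≤ 4 * X * B.card := hB
      _ ≤ 4 * X * (q * D.card) := by gcongr
      _ = _ := by ring
  have hRpos : (0 : ℝ) < R := by exact_mod_cast hR1
  have hDne : D.Nonempty := by
    rw [← Finset.card_pos]
    by_contra h
    have : D.card = 0 := by omega
    rw [this] at hD; simp at hD; omega
  -- `D` lies in one block of length `R` and one class modulo `q`, and has at least `R/(4Xq)`
  -- elements, so its extreme elements differ by `qy` with `y` of order at least `R/(Xq)`. Then `yψ
  -- ≤ 2ε` forces `ψ` to be small.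
  obtain ⟨h, hh, h', hh', y, hy, hDy⟩ :=
    exists_sub_eq_mul hq1 D hDne (r := r) fun h hh => (Finset.mem_filter.1 hh).2
  have hhB := Finset.mem_filter.1 (Finset.mem_filter.1 hh).1
  have hhB' := Finset.mem_filter.1 (Finset.mem_filter.1 hh').1
  have hlt := abs_sub_lt_of_ediv_eq hR1 hhB.2 hhB'.2
  have hyR : (y : ℝ) ≤ R := by
    have : (q : ℤ) * y < R := by linarith
    have h3 : (y : ℤ) ≤ q * y := le_mul_of_one_le_left (by positivity) (by exact_mod_cast hq1)
    exact_mod_cast (h3.trans this.le)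
  have hyψ : y * ψ ≤ 2 * ε := by
    have h3 := hdiff h hhB.1 h' hhB'.1
    rw [hy] at h3
    have h4 : |(y : ℝ) * (q * θ - round (q * θ))| = y * ψ := by
      rw [abs_mul, Nat.abs_cast]; rfl
    have h5 : |(y : ℝ) * (q * θ - round (q * θ))| ≤ 1 / 2 := by
      rw [h4]; refine le_trans ?_ hYψ; gcongr; linarith
    rw [← h4, ← distInt_eq_abs h5]
    have e1 : (y : ℝ) * (q * θ - round (q * θ)) =
        ((q * y : ℤ) : ℝ) * θ - ((y * round (q * θ) : ℤ) : ℝ) := by push_cast; ring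
    rw [e1, distInt_sub_int]
    exact_mod_cast h3
  have hX6 : 8 * X * q ≤ X ^ 9 := by
    have h8 : (8 : ℝ) ≤ X ^ 3 := by
      calc (8 : ℝ) = 2 ^ 3 := by norm_num
        _ ≤ X ^ 3 := by gcongr
    calc 8 * X * q ≤ X ^ 3 * X * X ^ 5 := by gcongr
      _ = X ^ 9 := by ring
  have hR10 : (R : ℝ) ≤ 8 * X * q * y := by
    have h3 : (D.card : ℝ) ≤ y + 1 := by exact_mod_cast hDy
    have h4 : (R : ℝ) ≤ 4 * X * q * (y + 1) := hD.trans (by gcongr)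
    have h5 : X ^ 9 ≤ R := by
      have e13 : X ^ 13 = X ^ 4 * X ^ 9 := by ring
      have : 16 * X ^ 9 ≤ X ^ 4 * X ^ 9 := by gcongr
      have : 0 < X ^ 9 := by positivity
      linarith
    linarith
  have hfin : ψ * Y ≤ X ^ 11 * ε := by
    have h3 : ψ * Y ≤ ψ * (2 * (8 * X * q * y)) := by gcongr; linarith
    have h4 : ψ * (2 * (8 * X * q * y)) = 2 * (8 * X * q) * (y * ψ) := by ring
    have h5 : 2 * (8 * X * q) * (y * ψ) ≤ 2 * X ^ 9 * (2 * ε) := by gcongr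
    have e11 : X ^ 11 * ε = X ^ 9 * ε * X ^ 2 := by ring
    have h6 : X ^ 9 * ε * 4 ≤ X ^ 9 * ε * X ^ 2 := by gcongr; nlinarith
    linarith
  rw [le_div_iff₀ hS0]
  -- The second alternative would give `ψY = 1/2`, against `ψY ≤ X^11 ε ≤ 1/16`.
  rcases min_choice S (1 / (2 * ψ)) with h1 | h1
  · have : Y = S := h1
    rwa [this] at hfin
  · exfalso
    have h2 : Y = 1 / (2 * ψ) := h1
    have h3 : ψ * Y = 1 / 2 := by rw [h2]; field_simp
    have e15 : ε * X ^ 15 = X ^ 11 * ε * X ^ 4 := by ring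
    have : X ^ 11 * ε * 16 ≤ X ^ 11 * ε * X ^ 4 := by gcongr
    linarith

/-! ### Taylor differences and polynomial phases that are often close to integers -/

open Polynomial

/-- Used to absorb degrees and numbers of terms into powers of `X`. -/
theorem natCast_le_pow {X : ℝ} (hX : 2 ≤ X) (n : ℕ) : (n : ℝ) ≤ X ^ n :=
  calc (n : ℝ) ≤ (2 ^ n : ℕ) := by exact_mod_cast Nat.lt_two_pow_self.le
    _ = 2 ^ n := by push_cast; rfl
    _ ≤ X ^ n := by gcongr

/-- Pigeonhole over at most `Q` possible denominators: a common denominator costs only a factor `Q`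
in density. -/
theorem exists_common_nat {ι : Type*} (s : Finset ι) {Q : ℝ} (hQ : 1 ≤ Q) (p : ι → ℕ → Prop)
    (h : ∀ i ∈ s, ∃ q : ℕ, 1 ≤ q ∧ (q : ℝ) ≤ Q ∧ p i q) :
    ∃ q : ℕ, 1 ≤ q ∧ (q : ℝ) ≤ Q ∧ ∃ s' ⊆ s, (s.card : ℝ) ≤ Q * s'.card ∧ ∀ i ∈ s', p i q := by
  classical
  choose! f hf using h
  obtain ⟨q, hq, hc⟩ := exists_card_le_card_mul_card_fiber s (Finset.Icc 1 ⌊Q⌋₊) f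
    (fun i hi => Finset.mem_Icc.2 ⟨(hf i hi).1, Nat.le_floor (hf i hi).2.1⟩)
    ⟨1, Finset.mem_Icc.2 ⟨le_rfl, Nat.le_floor (by simpa using hQ)⟩⟩
  rw [Finset.mem_Icc] at hq
  have hfl := Nat.floor_le (show 0 ≤ Q by linarith)
  refine ⟨q, hq.1, le_trans (by exact_mod_cast hq.2) hfl, s.filter fun i => f i = q,
    Finset.filter_subset _ _,
    hc.trans ?_, ?_⟩
  · rw [Nat.card_Icc, Nat.add_sub_cancel]
    gcongr
  · intro i hi
    obtain ⟨hi, hq'⟩ := Finset.mem_filter.1 hi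
    exact hq' ▸ (hf i hi).2.2

theorem taylor_coeff_eq_sum {P : ℝ[X]} {d : ℕ} (hP : P.natDegree ≤ d) (h : ℝ) (m : ℕ) :
    (taylor h P).coeff m =
      ∑ i ∈ Finset.range (d + 1), (i.choose m : ℝ) * h ^ (i - m) * P.coeff i := by
  rw [taylor_coeff, hasseDeriv_apply,
    P.sum_over_range' (by simp) (d + 1) (by omega), eval_finsetSum]
  refine Finset.sum_congr rfl fun i _ => ?_
  rw [eval_monomial]; ring

/-- The binomial term `i = m` is cancelled by `P` itself, so only coefficients of larger degree
survive. This triangular shape permits recovery of coefficients from the top down. -/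
theorem taylor_sub_coeff {P : ℝ[X]} {d : ℕ} (hP : P.natDegree ≤ d) (h : ℝ) (m : ℕ) :
    (taylor h P - P).coeff m =
      ∑ i ∈ Finset.Ioc m d, (i.choose m : ℝ) * h ^ (i - m) * P.coeff i := by
  rw [coeff_sub, taylor_coeff_eq_sum hP]
  rcases lt_or_ge d m with hm | hm
  · rw [Finset.Ioc_eq_empty (by omega), coeff_eq_zero_of_natDegree_lt (by omega),
      Finset.sum_eq_zero]
    · simp
    · intro i hi
      rw [Finset.mem_range] at hi
      rw [Nat.choose_eq_zero_of_lt (by omega)]; simp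
  · have : Finset.range (d + 1) = Finset.range m ∪ insert m (Finset.Ioc m d) := by
      ext i; simp only [Finset.mem_range, Finset.mem_union, Finset.mem_insert, Finset.mem_Ioc]
      omega
    rw [this, Finset.sum_union, Finset.sum_insert (by simp), Finset.sum_eq_zero]
    · simp
    · intro i hi
      rw [Finset.mem_range] at hi
      rw [Nat.choose_eq_zero_of_lt hi]; simp
    · rw [Finset.disjoint_left]
      intro i
      simp only [Finset.mem_range, Finset.mem_insert, Finset.mem_Ioc]
      omega

theorem natDegree_taylor_sub_le {P : ℝ[X]} {d : ℕ} (hP : P.natDegree ≤ d + 1) (h : ℝ) :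
    (taylor h P - P).natDegree ≤ d := by
  rw [natDegree_le_iff_coeff_eq_zero]
  intro m hm
  rw [taylor_sub_coeff hP, Finset.Ioc_eq_empty (by omega), Finset.sum_empty]

/-- Linear Vinogradov lemma for sets of polynomial density. -/
theorem vinogradov_linear_pow (e : ℕ) : ∃ A : ℕ, ∀ (X T ε θ : ℝ) (B : Finset ℤ), 2 ≤ X →
    X ^ A ≤ T → ε * X ^ A ≤ 1 → (∀ h ∈ B, |(h : ℝ)| ≤ X ^ e * T) → T ≤ X ^ e * B.card →
    (∀ h ∈ B, distInt (θ * h) ≤ ε) →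
    ∃ q : ℕ, 1 ≤ q ∧ (q : ℝ) ≤ X ^ A ∧ distInt (q * θ) ≤ X ^ A * ε / T := by
  refine ⟨15 * (2 * e + 1), fun X T ε θ B hX hT hε hB hcard hθ => ?_⟩
  have hX1 : 1 ≤ X := by linarith
  have hX0 : 0 < X := by linarith
  have hle : ∀ {i j : ℕ}, i ≤ j → X ^ i ≤ X ^ j := fun h => pow_le_pow_right₀ hX1 h
  have hT0 : 0 < T := lt_of_lt_of_le (by positivity) hT
  have hXe : 1 ≤ X ^ e := one_le_pow₀ hX1
  have hTT : T ≤ X ^ e * T := le_mul_of_one_le_left hT0.le hXe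
  have hε0 : 0 ≤ ε := by
    have : B.Nonempty := by
      rw [← Finset.card_pos]; by_contra h
      have : B.card = 0 := by omega
      rw [this] at hcard; simp at hcard; linarith
    obtain ⟨h, hh⟩ := this
    exact (distInt_nonneg _).trans (hθ h hh)
  -- The range `X^e T` and the density `X^(-e)` combine to density `X^(-2e)` in `[-S, S]` with `S =
  -- X^e T`. The extra 1 in the exponent keeps the base at least 2 when `e = 0`.
  obtain ⟨q, h1, h2, h3⟩ := vinogradov_linear (X := X ^ (2 * e + 1)) (S := X ^ e * T) (ε := ε)
    (θ := θ) (hX.trans (le_self_pow₀ hX1 (by omega)))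
    (by rw [← pow_mul]; exact (hle (by omega)).trans (hT.trans hTT))
    (by rw [← pow_mul, mul_comm (2 * e + 1)]; exact hε) B hB
    (by
      calc X ^ e * T ≤ X ^ e * (X ^ e * B.card) := by gcongr
        _ = X ^ (2 * e) * B.card := by ring
        _ ≤ X ^ (2 * e + 1) * B.card := by gcongr; omega) hθ
  refine ⟨q, h1, ?_, h3.trans ?_⟩
  · rw [← pow_mul] at h2; exact h2.trans (hle (by omega))
  · rw [← pow_mul]
    have := hle (show (2 * e + 1) * 11 ≤ 15 * (2 * e + 1) by omega)
    gcongr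

/-- If many differences `P(x + h) - P(x)` have coefficients close to rationals with a fixed
denominator, then so do the coefficients of `P` of degree at least two. -/
theorem coeff_of_taylor_sub (d e n : ℕ) : ∃ A : ℕ, ∀ (X T ε : ℝ) (P : ℝ[X]) (q : ℕ)
    (B : Finset ℤ), 2 ≤ X → X ^ A ≤ T → 0 ≤ ε → ε * X ^ A ≤ T → P.natDegree ≤ d →
    (∀ h ∈ B, |(h : ℝ)| ≤ X ^ e * T) → T ≤ X ^ e * B.card →
    (∀ h ∈ B, ∀ j, 1 ≤ j → distInt (q * (taylor (h : ℝ) P - P).coeff j) ≤ ε / T ^ j) →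
    ∃ r : ℕ, 1 ≤ r ∧ (r : ℝ) ≤ X ^ A ∧
      ∀ j, 2 ≤ j → d < j + n → distInt (r * q * P.coeff j) ≤ X ^ A * ε / T ^ j := by
  -- Downward induction on the degree: `n` counts how many top coefficients have been treated.
  induction n with
  | zero =>
    refine ⟨0, fun X T ε P q B hX hT hε0 hε hP hB hcard h => ⟨1, le_rfl, by simp, ?_⟩⟩
    intro j _ hj
    have hT0 : 0 < T := lt_of_lt_of_le (by positivity) hT
    rw [coeff_eq_zero_of_natDegree_lt (by omega)]
    simp only [mul_zero, distInt_zero]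
    positivity
  | succ n ih =>
    obtain ⟨A, ih⟩ := ih
    obtain ⟨A₁, hlin⟩ := vinogradov_linear_pow e
    set K := 2 * d + 1 + e * d with hK
    refine ⟨A + K + A₁ + d, fun X T ε P q B hX hT hε0 hε hP hB hcard h => ?_⟩
    have hX1 : 1 ≤ X := by linarith
    have hX0 : 0 < X := by linarith
    have hle : ∀ {i j : ℕ}, i ≤ j → X ^ i ≤ X ^ j := fun h => pow_le_pow_right₀ hX1 h
    have hT0 : 0 < T := lt_of_lt_of_le (by positivity) hT
    have hT1 : 1 ≤ T := (one_le_pow₀ hX1).trans hT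
    obtain ⟨r, hr1, hrA, hr⟩ := ih X T ε P q B hX ((hle (by omega)).trans hT) hε0
      (le_trans (by gcongr; omega) hε) hP hB hcard h
    have hmono : ∀ j, X ^ A * ε / T ^ j ≤ X ^ (A + K + A₁ + d) * ε / T ^ j := by
      intro j; gcongr; omega
    by_cases hn : 2 + n ≤ d
    swap
    · exact ⟨r, hr1, hrA.trans (hle (by omega)), fun j h2 hj =>
        (hr j h2 (by omega)).trans (hmono j)⟩
    obtain ⟨j, hj⟩ : ∃ j, d = j + n := ⟨d - n, by omega⟩
    have hj2 : 2 ≤ j := by omega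
    set ε' := X ^ (A + K) * ε / T ^ (j - 1) with hε'
    have hTj : T ^ j = T ^ (j - 1) * T := by rw [← pow_succ]; congr 1; omega
    -- The coefficient of degree `j-1` in the difference is `j h c_j` plus integer multiples of
    -- `c_i` with `i > j`. These multiples are of size about `T^(i-j+1)`, which turns the known
    -- error `T^(-i)` into `T^(-(j-1))`. What is left is a linear phase in `h`.
    have hmain : ∀ h ∈ B, distInt ((r * q * j * P.coeff j) * h) ≤ ε' := by
      intro x hx
      have hsplit : Finset.Ioc (j - 1) d = insert j (Finset.Ioc j d) := by
        ext i; simp only [Finset.mem_insert, Finset.mem_Ioc]; omega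
      have hc := taylor_sub_coeff hP (x : ℝ) (j - 1)
      rw [hsplit, Finset.sum_insert (by simp)] at hc
      have hch : j.choose (j - 1) = j := by
        rw [Nat.choose_symm_of_eq_add (show j = (j - 1) + 1 by omega), Nat.choose_one_right]
      rw [hch, show j - (j - 1) = 1 by omega, pow_one] at hc
      have heq : (r * q * j * P.coeff j) * x =
          ((r : ℤ) : ℝ) * (q * (taylor (x : ℝ) P - P).coeff (j - 1)) -
          ∑ i ∈ Finset.Ioc j d, ((i.choose (j - 1) * x ^ (i - (j - 1)) : ℤ) : ℝ) *
            (r * q * P.coeff i) := by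
        have : ∑ i ∈ Finset.Ioc j d, ((i.choose (j - 1) * x ^ (i - (j - 1)) : ℤ) : ℝ) *
            (r * q * P.coeff i) = r * q * ∑ i ∈ Finset.Ioc j d,
              (i.choose (j - 1) : ℝ) * (x : ℝ) ^ (i - (j - 1)) * P.coeff i := by
          rw [Finset.mul_sum]; refine Finset.sum_congr rfl fun i _ => ?_
          push_cast; ring
        rw [this, hc]; push_cast; ring
      rw [heq]
      refine (distInt_sub_le _ _).trans ?_
      have hA1 : distInt (((r : ℤ) : ℝ) * (q * (taylor (x : ℝ) P - P).coeff (j - 1))) ≤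
          X ^ A * ε / T ^ (j - 1) := by
        refine (distInt_int_mul_le _ _).trans ?_
        rw [Int.cast_natCast, Nat.abs_cast, mul_div_assoc]
        exact mul_le_mul hrA (h x hx (j - 1) (by omega)) (distInt_nonneg _) (by positivity)
      have hA2 : distInt (∑ i ∈ Finset.Ioc j d,
          ((i.choose (j - 1) * x ^ (i - (j - 1)) : ℤ) : ℝ) * (r * q * P.coeff i)) ≤
          d * (X ^ (d + e * d) * (X ^ A * ε / T ^ (j - 1))) := by
        refine (distInt_sum_le _ _).trans ?_
        have hcardle : ((Finset.Ioc j d).card : ℝ) ≤ d := by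
          rw [Nat.card_Ioc]; exact_mod_cast Nat.sub_le _ _
        refine (Finset.sum_le_card_nsmul _ _ (X ^ (d + e * d) * (X ^ A * ε / T ^ (j - 1)))
          fun i hi => ?_).trans ?_
        · rw [Finset.mem_Ioc] at hi
          refine (distInt_int_mul_le _ _).trans ?_
          have h1 := hr i (by omega) (by omega)
          have h2 : |((i.choose (j - 1) * x ^ (i - (j - 1)) : ℤ) : ℝ)| ≤
              X ^ d * (X ^ e * T) ^ (i - (j - 1)) := by
            push_cast
            rw [abs_mul, abs_pow, Nat.abs_cast]
            gcongr
            · calc (i.choose (j - 1) : ℝ) ≤ (2 ^ i : ℕ) := by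
                    exact_mod_cast Nat.choose_le_two_pow i (j - 1)
                _ = 2 ^ i := by push_cast; rfl
                _ ≤ X ^ i := by gcongr
                _ ≤ X ^ d := hle hi.2
            · exact hB x hx
          have hTi : T ^ i = T ^ (i - (j - 1)) * T ^ (j - 1) := by
            rw [← pow_add]; congr 1; omega
          calc _ ≤ X ^ d * (X ^ e * T) ^ (i - (j - 1)) * (X ^ A * ε / T ^ i) :=
                mul_le_mul h2 h1 (distInt_nonneg _) (by positivity)
            _ = X ^ d * X ^ (e * (i - (j - 1))) * (X ^ A * ε / T ^ (j - 1)) := by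
                rw [mul_pow, hTi, pow_mul]; field_simp
            _ ≤ _ := by
                rw [← pow_add]
                have : i - (j - 1) ≤ d := by omega
                gcongr
        · rw [nsmul_eq_mul]; gcongr
      have hd := natCast_le_pow hX (d + 1)
      push_cast at hd
      have h3 : 1 + (d : ℝ) * X ^ (d + e * d) ≤ X ^ K := by
        have h4 : (1 : ℝ) ≤ X ^ (d + e * d) := one_le_pow₀ hX1
        calc 1 + (d : ℝ) * X ^ (d + e * d) ≤ (d + 1) * X ^ (d + e * d) := by linarith
          _ ≤ X ^ (d + 1) * X ^ (d + e * d) := by gcongr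
          _ = X ^ K := by rw [← pow_add]; congr 1; omega
      calc _ ≤ X ^ A * ε / T ^ (j - 1) +
            d * (X ^ (d + e * d) * (X ^ A * ε / T ^ (j - 1))) := add_le_add hA1 hA2
        _ = (1 + d * X ^ (d + e * d)) * (X ^ A * ε / T ^ (j - 1)) := by ring
        _ ≤ X ^ K * (X ^ A * ε / T ^ (j - 1)) := by gcongr
        _ = ε' := by rw [hε', pow_add]; ring
    have hTle : T ≤ T ^ (j - 1) := le_self_pow₀ hT1 (by omega)
    obtain ⟨s, hs1, hsA, hs⟩ := hlin X T ε' (r * q * j * P.coeff j) B hX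
      ((hle (by omega)).trans hT) (by
        rw [hε', div_mul_eq_mul_div, div_le_one (by positivity)]
        calc X ^ (A + K) * ε * X ^ A₁ = ε * X ^ (A + K + A₁) := by ring
          _ ≤ ε * X ^ (A + K + A₁ + d) := by
              have := hle (show A + K + A₁ ≤ A + K + A₁ + d by omega)
              gcongr
          _ ≤ _ := hε.trans hTle) hB hcard hmain
    have hjd : (j : ℝ) ≤ X ^ d := by
      calc (j : ℝ) ≤ d := by exact_mod_cast (by omega : j ≤ d)
        _ ≤ X ^ d := natCast_le_pow hX d
    -- The factor `j` clears the binomial coefficient in `j h c_j`.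
    refine ⟨s * j * r, ?_, ?_, ?_⟩
    · have : 0 < s * j * r := by positivity
      exact this
    · push_cast
      calc (s : ℝ) * j * r ≤ X ^ A₁ * X ^ d * X ^ A := by gcongr
        _ = X ^ (A + A₁ + d) := by ring
        _ ≤ _ := hle (by omega)
    · intro i hi2 hi
      rcases eq_or_ne i j with rfl | hne
      · have : ((s * i * r : ℕ) : ℝ) * q * P.coeff i = s * (r * q * i * P.coeff i) := by
          push_cast; ring
        rw [this]
        refine hs.trans ?_
        rw [hε', hTj]
        calc X ^ A₁ * (X ^ (A + K) * ε / T ^ (i - 1)) / T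
            = X ^ (A + K + A₁) * ε / (T ^ (i - 1) * T) := by rw [pow_add _ _ A₁]; field_simp
          _ ≤ _ := by
              have := hle (show A + K + A₁ ≤ A + K + A₁ + d by omega)
              gcongr
      · have : ((s * j * r : ℕ) : ℝ) * q * P.coeff i =
            ((s * j : ℕ) : ℝ) * (r * q * P.coeff i) := by
          push_cast; ring
        rw [this]
        refine (distInt_nat_mul_le _ _).trans ?_
        have h1 := hr i hi2 (by omega)
        push_cast
        calc (s : ℝ) * j * distInt (r * q * P.coeff i)
            ≤ X ^ A₁ * X ^ d * (X ^ A * ε / T ^ i) := by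
              refine mul_le_mul ?_ h1 (distInt_nonneg _) (by positivity)
              gcongr
          _ = X ^ (A + A₁ + d) * ε / T ^ i := by rw [pow_add, pow_add]; ring
          _ ≤ _ := by gcongr; omega

/-- A dense set of integers has many popular differences. -/
theorem exists_popular_differences (e : ℕ) {X T : ℝ} (hX : 2 ≤ X) (hT : 1 ≤ T) (B : Finset ℤ)
    (hB : ∀ h ∈ B, |(h : ℝ)| ≤ X ^ e * T) (hcard : T ≤ X ^ e * B.card) :
    ∃ D : Finset ℤ, (∀ r ∈ D, |(r : ℝ)| ≤ X ^ (e + 1) * T) ∧ T ≤ X ^ (3 * e + 4) * D.card ∧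
      ∀ r ∈ D, T ≤ X ^ (3 * e + 4) * (B.filter fun h => h + r ∈ B).card := by
  have hX1 : 1 ≤ X := by linarith
  have hX0 : 0 < X := by linarith
  have hBpos : 0 < (B.card : ℝ) := by
    by_contra h
    have : (B.card : ℝ) = 0 := le_antisymm (not_lt.1 h) (by positivity)
    rw [this, mul_zero] at hcard; linarith
  set R : ℤ := ⌊2 * (X ^ e * T)⌋
  have hXT : 1 ≤ X ^ e * T := one_le_mul_of_one_le_of_one_le (one_le_pow₀ hX1) hT
  have hR0 : 0 ≤ R := Int.floor_nonneg.2 (by linarith)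
  have hR : (R : ℝ) ≤ 2 * (X ^ e * T) := Int.floor_le _
  set D₀ := Finset.Icc (-R) R
  have hD₀ : (D₀.card : ℝ) = 2 * R + 1 := by
    have : (D₀.card : ℤ) = 2 * R + 1 := by
      simp only [D₀, Int.card_Icc]; rw [Int.toNat_of_nonneg (by omega)]; ring
    exact_mod_cast this
  have hdiff : ∀ h ∈ B, ∀ h' ∈ B, h' - h ∈ D₀ := by
    intro h hh h' hh'
    have h1 := abs_le.1 (hB h hh)
    have h2 := abs_le.1 (hB h' hh')
    have h3 : h' - h ≤ R := Int.le_floor.2 (by push_cast; linarith)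
    have h4 : h - h' ≤ R := Int.le_floor.2 (by push_cast; linarith)
    rw [Finset.mem_Icc]; omega
  -- Double counting of the pairs `(h, h')` in `B` by their difference `r = h' - h`.
  have hsum : (B.card : ℝ) * B.card ≤
      ∑ r ∈ D₀, ((B.filter fun h => h + r ∈ B).card : ℝ) := by
    have h1 := Finset.sum_card_bipartiteAbove_eq_sum_card_bipartiteBelow
      (s := D₀) (t := B) fun r h => h + r ∈ B
    simp only [Finset.bipartiteAbove, Finset.bipartiteBelow] at h1
    have h2 : B.card * B.card ≤ ∑ r ∈ D₀, (B.filter fun h => h + r ∈ B).card := by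
      rw [h1, ← smul_eq_mul]
      refine Finset.card_nsmul_le_sum _ _ _ fun h hh => ?_
      refine Finset.card_le_card_of_injOn (fun h' => h' - h) (fun h' hh' => ?_)
        (fun x _ y _ hxy => by simpa using hxy)
      simp only [Finset.coe_filter, Set.mem_ofPred_eq]
      exact ⟨hdiff h hh h' hh', by simpa using hh'⟩
    exact_mod_cast h2
  have h8 : (8 : ℝ) ≤ X ^ 3 := by
    calc (8 : ℝ) = 2 ^ 3 := by norm_num
      _ ≤ X ^ 3 := by gcongr
  have hY : (D₀.card : ℝ) ≤ X ^ (2 * e + 3) * B.card := by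
    calc (D₀.card : ℝ) ≤ 8 * (X ^ e * T) := by rw [hD₀]; linarith
      _ ≤ X ^ 3 * (X ^ e * (X ^ e * B.card)) := by gcongr
      _ = _ := by ring
  have hpop := card_le_mul_card_popular D₀ (fun r => ((B.filter fun h => h + r ∈ B).card : ℝ))
    (B := B.card) (Y := X ^ (2 * e + 3)) hBpos (by positivity)
    (fun r _ => by exact_mod_cast Finset.card_filter_le _ _)
    (by
      calc (D₀.card : ℝ) * B.card ≤ X ^ (2 * e + 3) * B.card * B.card := by gcongr
        _ = X ^ (2 * e + 3) * (B.card * B.card) := by ring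
        _ ≤ _ := by gcongr)
  have h2Y : ∀ z : ℝ, 0 ≤ z → X ^ e * (2 * X ^ (2 * e + 3) * z) ≤ X ^ (3 * e + 4) * z := by
    intro z hz
    have e1 : X ^ (3 * e + 4) * z = X ^ e * (X * X ^ (2 * e + 3) * z) := by ring
    rw [e1]; gcongr
  have hBD : (B.card : ℝ) ≤ D₀.card := by
    obtain ⟨h, hh⟩ : B.Nonempty := by
      rw [← Finset.card_pos]; exact_mod_cast hBpos
    exact_mod_cast Finset.card_le_card_of_injOn (fun h' => h' - h)
      (fun h' hh' => hdiff h hh h' hh') (fun x _ y _ hxy => by simpa using hxy)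
  obtain ⟨D, hD⟩ : ∃ D, D = D₀.filter fun r =>
    (B.card : ℝ) ≤ 2 * X ^ (2 * e + 3) * (B.filter fun h => h + r ∈ B).card := ⟨_, rfl⟩
  rw [← hD] at hpop
  refine ⟨D, fun r hr => ?_, (hcard.trans ?_).trans (h2Y _ (Nat.cast_nonneg _)), fun r hr =>
    (hcard.trans ?_).trans (h2Y _ (Nat.cast_nonneg _))⟩
  · rw [hD] at hr
    have := Finset.mem_Icc.1 (Finset.mem_filter.1 hr).1
    have h1 : |(r : ℝ)| ≤ R := by
      rw [abs_le]; exact ⟨by exact_mod_cast this.1, by exact_mod_cast this.2⟩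
    calc |(r : ℝ)| ≤ 2 * (X ^ e * T) := h1.trans hR
      _ ≤ X * (X ^ e * T) := by gcongr
      _ = _ := by ring
  · gcongr; exact hBD.trans hpop
  · rw [hD] at hr
    gcongr; exact (Finset.mem_filter.1 hr).2

/-- Isolates the linear coefficient once the higher ones are known; subtracting two values removes
the constant term. -/
theorem coeff_one_mul_sub {P : ℝ[X]} {d : ℕ} (hP : P.natDegree ≤ d + 1) (x y : ℝ) :
    P.coeff 1 * (x - y) = P.eval x - P.eval y -
      ∑ i ∈ Finset.Icc 2 (d + 1), (x ^ i - y ^ i) * P.coeff i := by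
  have h : ∀ z : ℝ, P.eval z = P.coeff 0 + P.coeff 1 * z +
      ∑ i ∈ Finset.Icc 2 (d + 1), P.coeff i * z ^ i := by
    intro z
    have h1 : Finset.range (d + 1 + 1) = insert 0 (insert 1 (Finset.Icc 2 (d + 1))) := by
      ext i; simp only [Finset.mem_range, Finset.mem_insert, Finset.mem_Icc]; omega
    rw [eval_eq_sum_range' (show P.natDegree < d + 1 + 1 by omega), h1, Finset.sum_insert (by simp),
      Finset.sum_insert (by simp)]
    simp; ring
  rw [h x, h y]
  have : ∑ i ∈ Finset.Icc 2 (d + 1), (x ^ i - y ^ i) * P.coeff i =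
      ∑ i ∈ Finset.Icc 2 (d + 1), P.coeff i * x ^ i -
      ∑ i ∈ Finset.Icc 2 (d + 1), P.coeff i * y ^ i := by
    rw [← Finset.sum_sub_distrib]; exact Finset.sum_congr rfl fun i _ => by ring
  rw [this]; ring

/-- Vinogradov's lemma for polynomial phases. -/
theorem vinogradov_polynomial (d : ℕ) : ∀ e : ℕ, ∃ A : ℕ, ∀ (X T ε : ℝ) (P : ℝ[X])
    (B : Finset ℤ), 2 ≤ X → X ^ A ≤ T → ε * X ^ A ≤ 1 → P.natDegree ≤ d →
    (∀ h ∈ B, |(h : ℝ)| ≤ X ^ e * T) → T ≤ X ^ e * B.card →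
    (∀ h ∈ B, distInt (P.eval (h : ℝ)) ≤ ε) →
    ∃ q : ℕ, 1 ≤ q ∧ (q : ℝ) ≤ X ^ A ∧
      ∀ j, 1 ≤ j → distInt (q * P.coeff j) ≤ X ^ A * ε / T ^ j := by
  have hne : ∀ {X T ε : ℝ} {e : ℕ} {P : ℝ[X]} {B : Finset ℤ}, 1 ≤ T → T ≤ X ^ e * B.card →
      (∀ h ∈ B, distInt (P.eval (h : ℝ)) ≤ ε) → B.Nonempty ∧ 0 ≤ ε := by
    intro X T ε e P B hT hcard hP
    have : B.Nonempty := by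
      rw [← Finset.card_pos]; by_contra h
      have : B.card = 0 := by omega
      rw [this] at hcard; simp at hcard; linarith
    obtain ⟨h, hh⟩ := this
    exact ⟨⟨h, hh⟩, (distInt_nonneg _).trans (hP h hh)⟩
  induction d with
  | zero =>
    refine fun e => ⟨0, fun X T ε P B hX hT hε hP hB hcard h => ⟨1, le_rfl, by simp, ?_⟩⟩
    intro j hj
    obtain ⟨-, hε0⟩ := hne (by simpa using hT) hcard h
    have hT0 : 1 ≤ T := by simpa using hT
    rw [coeff_eq_zero_of_natDegree_lt (by omega)]
    simp only [mul_zero, distInt_zero]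
    positivity
  | succ d ih =>
    intro e
    -- The density exponent has to vary in the induction, since popular differences are only dense
    -- up to `X^(3e+4)`.
    obtain ⟨A₁, hA₁⟩ := ih (3 * e + 4)
    obtain ⟨A₂, hA₂⟩ := coeff_of_taylor_sub (d + 1) (3 * e + 4 + A₁) (d + 1)
    obtain ⟨A₃, hA₃⟩ := vinogradov_linear_pow (e + 1)
    set K := A₁ + A₂ + (d + 2) + e * (d + 1) + 3
    refine ⟨A₁ + A₂ + A₃ + K, fun X T ε P B hX hT hε hP hB hcard h => ?_⟩
    have hX1 : 1 ≤ X := by linarith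
    have hX0 : 0 < X := by linarith
    have hle : ∀ {i j : ℕ}, i ≤ j → X ^ i ≤ X ^ j := fun h => pow_le_pow_right₀ hX1 h
    have hT1 : 1 ≤ T := (one_le_pow₀ hX1).trans hT
    have hT0 : 0 < T := by linarith
    obtain ⟨⟨h₀, hh₀⟩, hε0⟩ := hne hT1 hcard h
    have hεle : ∀ {i : ℕ}, i ≤ A₁ + A₂ + A₃ + K → X ^ i * ε ≤ 1 := fun hi =>
      le_trans (by rw [mul_comm]; gcongr) hε
    obtain ⟨D, hD, hDcard, hDpop⟩ := exists_popular_differences e hX hT1 B hB hcard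
    -- If `P(h)` and `P(h + r)` are both within `ε` of integers, then `P(x + r) - P(x)`, of smaller
    -- degree, is within `2ε` of an integer at `h`.
    have hstep : ∀ r ∈ D, ∃ q : ℕ, 1 ≤ q ∧ (q : ℝ) ≤ X ^ A₁ ∧ ∀ j, 1 ≤ j →
        distInt (q * (taylor (r : ℝ) P - P).coeff j) ≤ X ^ A₁ * (2 * ε) / T ^ j := by
      intro r hr
      refine hA₁ X T (2 * ε) _ (B.filter fun h => h + r ∈ B) hX ((hle (by omega)).trans hT) ?_
        (natDegree_taylor_sub_le hP r) (fun h hh => ?_) (hDpop r hr) (fun x hx => ?_)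
      · have := hεle (show A₁ + 1 ≤ A₁ + A₂ + A₃ + K by omega)
        calc 2 * ε * X ^ A₁ ≤ X * ε * X ^ A₁ := by gcongr
          _ = X ^ (A₁ + 1) * ε := by ring
          _ ≤ 1 := this
      · refine (hB h (Finset.mem_filter.1 hh).1).trans ?_
        have := hle (show e ≤ 3 * e + 4 by omega)
        gcongr
      · obtain ⟨h1, h2⟩ := Finset.mem_filter.1 hx
        rw [eval_sub, taylor_eval]
        have h3 := h (x + r) h2
        push_cast at h3
        refine (distInt_sub_le _ _).trans ?_
        linarith [h x h1]
    obtain ⟨q, hq1, hqA, D', hD'D, hD'card, hD'⟩ :=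
      exists_common_nat D (one_le_pow₀ hX1) _ hstep
    obtain ⟨r, hr1, hrA, hr⟩ := hA₂ X T (X ^ A₁ * (2 * ε)) P q D' hX ((hle (by omega)).trans hT)
      (by positivity) (by
        have := hεle (show A₁ + A₂ + 1 ≤ A₁ + A₂ + A₃ + K by omega)
        calc X ^ A₁ * (2 * ε) * X ^ A₂ ≤ X ^ A₁ * (X * ε) * X ^ A₂ := by gcongr
          _ = X ^ (A₁ + A₂ + 1) * ε := by ring
          _ ≤ T := this.trans hT1) hP
      (fun h hh => by
        refine (hD h (hD'D hh)).trans ?_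
        have := hle (show e + 1 ≤ 3 * e + 4 + A₁ by omega)
        gcongr)
      (by
        rw [pow_add, mul_assoc]
        refine hDcard.trans ?_
        gcongr) hD'
    have hr' : ∀ j, 2 ≤ j →
        distInt ((r * q : ℕ) * P.coeff j) ≤ X ^ (A₁ + A₂ + 1) * ε / T ^ j := by
      intro j hj
      push_cast
      refine (hr j hj (by omega)).trans ?_
      have : X ^ A₂ * (X ^ A₁ * (2 * ε)) ≤ X ^ (A₁ + A₂ + 1) * ε := by
        calc X ^ A₂ * (X ^ A₁ * (2 * ε)) ≤ X ^ A₂ * (X ^ A₁ * (X * ε)) := by gcongr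
          _ = _ := by ring
      gcongr
    have hrq : ((r * q : ℕ) : ℝ) ≤ X ^ (A₁ + A₂) := by
      push_cast
      calc (r : ℝ) * q ≤ X ^ A₂ * X ^ A₁ := by gcongr
        _ = _ := by ring
    have hrq1 : 1 ≤ r * q := Nat.mul_pos hr1 hq1
    generalize hQ : r * q = Q at hr' hrq hrq1
    -- In degree `i ≥ 2` the factor `x^i - h₀^i`, of order `T^i`, cancels the error `T^(-i)` of `Q
    -- c_i`. So `Q c_1 (x - h₀)` is close to an integer throughout the translate of `B` by `-h₀`.
    have hlin : ∀ x ∈ B, distInt ((Q * P.coeff 1) * ((x - h₀ : ℤ) : ℝ)) ≤ X ^ K * ε := by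
      intro x hx
      have heq : (Q * P.coeff 1) * ((x - h₀ : ℤ) : ℝ) =
          (Q * P.eval (x : ℝ) - Q * P.eval (h₀ : ℝ)) -
          ∑ i ∈ Finset.Icc 2 (d + 1), ((x ^ i - h₀ ^ i : ℤ) : ℝ) * (Q * P.coeff i) := by
        push_cast
        rw [mul_assoc, coeff_one_mul_sub hP, mul_sub, mul_sub, Finset.mul_sum]
        congr 1
        exact Finset.sum_congr rfl fun i _ => by ring
      rw [heq]
      have h1 : distInt (Q * P.eval (x : ℝ) - Q * P.eval (h₀ : ℝ)) ≤ 2 * (X ^ (A₁ + A₂) * ε) := by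
        refine (distInt_sub_le _ _).trans ?_
        have : ∀ y ∈ B, distInt (Q * P.eval (y : ℝ)) ≤ X ^ (A₁ + A₂) * ε := fun y hy =>
          (distInt_nat_mul_le _ _).trans
            (mul_le_mul hrq (h y hy) (distInt_nonneg _) (by positivity))
        linarith [this x hx, this h₀ hh₀]
      have h2 : distInt (∑ i ∈ Finset.Icc 2 (d + 1),
          ((x ^ i - h₀ ^ i : ℤ) : ℝ) * (Q * P.coeff i)) ≤
          (d + 1) * (2 * (X ^ (e * (d + 1)) * (X ^ (A₁ + A₂ + 1) * ε))) := by
        refine (distInt_sum_le _ _).trans ?_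
        refine (Finset.sum_le_card_nsmul _ _
          (2 * (X ^ (e * (d + 1)) * (X ^ (A₁ + A₂ + 1) * ε))) fun i hi => ?_).trans ?_
        · rw [Finset.mem_Icc] at hi
          refine (distInt_int_mul_le _ _).trans ?_
          have h3 : |((x ^ i - h₀ ^ i : ℤ) : ℝ)| ≤ 2 * (X ^ e * T) ^ i := by
            push_cast
            refine (abs_sub _ _).trans ?_
            rw [abs_pow, abs_pow, two_mul]
            exact add_le_add (pow_le_pow_left₀ (abs_nonneg _) (hB x hx) _)
              (pow_le_pow_left₀ (abs_nonneg _) (hB h₀ hh₀) _)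
          calc _ ≤ 2 * (X ^ e * T) ^ i * (X ^ (A₁ + A₂ + 1) * ε / T ^ i) :=
                mul_le_mul h3 (hr' i hi.1) (distInt_nonneg _) (by positivity)
            _ = 2 * (X ^ (e * i) * (X ^ (A₁ + A₂ + 1) * ε)) := by
                rw [mul_pow, pow_mul]; field_simp
            _ ≤ _ := by
                have := hle (Nat.mul_le_mul_left e hi.2)
                gcongr
        · rw [nsmul_eq_mul]
          gcongr
          rw [Nat.card_Icc]
          exact_mod_cast (by omega : d + 1 + 1 - 2 ≤ d + 1)
      have hd := natCast_le_pow hX (d + 2)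
      push_cast at hd
      have hge : (1 : ℝ) ≤ X ^ (e * (d + 1)) := one_le_pow₀ hX1
      calc _ ≤ 2 * (X ^ (A₁ + A₂) * ε) +
            (d + 1) * (2 * (X ^ (e * (d + 1)) * (X ^ (A₁ + A₂ + 1) * ε))) :=
            (distInt_sub_le _ _).trans (add_le_add h1 h2)
        _ ≤ 2 * (X ^ (e * (d + 1)) * (X ^ (A₁ + A₂ + 1) * ε)) +
            (d + 1) * (2 * (X ^ (e * (d + 1)) * (X ^ (A₁ + A₂ + 1) * ε))) := by
            have h5 : X ^ (A₁ + A₂) * ε ≤ X ^ (e * (d + 1)) * (X ^ (A₁ + A₂ + 1) * ε) := by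
              calc X ^ (A₁ + A₂) * ε ≤ X ^ (A₁ + A₂ + 1) * ε := by
                    have := hle (show A₁ + A₂ ≤ A₁ + A₂ + 1 by omega)
                    gcongr
                _ ≤ _ := le_mul_of_one_le_left (by positivity) hge
            linarith
        _ = 2 * (d + 2) * (X ^ (e * (d + 1)) * (X ^ (A₁ + A₂ + 1) * ε)) := by ring
        _ ≤ X * X ^ (d + 2) * (X ^ (e * (d + 1)) * (X ^ (A₁ + A₂ + 1) * ε)) := by gcongr
        _ = X ^ (d + 2 + 2 + e * (d + 1) + A₁ + A₂) * ε := by ring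
        _ ≤ X ^ K * ε := by
            have := hle (show d + 2 + 2 + e * (d + 1) + A₁ + A₂ ≤ K by omega)
            gcongr
    obtain ⟨s, hs1, hsA, hs⟩ := hA₃ X T (X ^ K * ε) (Q * P.coeff 1)
      (B.image fun x => x - h₀) hX ((hle (by omega)).trans hT)
      (by
        rw [mul_right_comm, ← pow_add]
        exact hεle (by omega))
      (by
        intro y hy
        obtain ⟨x, hx, rfl⟩ := Finset.mem_image.1 hy
        push_cast
        refine (abs_sub _ _).trans ?_
        have := hB x hx
        have := hB h₀ hh₀
        calc |(x : ℝ)| + |(h₀ : ℝ)| ≤ 2 * (X ^ e * T) := by linarith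
          _ ≤ X * (X ^ e * T) := by gcongr
          _ = _ := by ring)
      (by
        rw [Finset.card_image_of_injective _ fun x y hxy => by simpa using hxy]
        refine hcard.trans ?_
        have := hle (show e ≤ e + 1 by omega)
        gcongr)
      (by
        intro y hy
        obtain ⟨x, hx, rfl⟩ := Finset.mem_image.1 hy
        exact hlin x hx)
    refine ⟨s * Q, Nat.mul_pos hs1 hrq1, ?_, fun j hj => ?_⟩
    · push_cast
      calc (s : ℝ) * Q ≤ X ^ A₃ * X ^ (A₁ + A₂) := by gcongr
        _ = X ^ (A₁ + A₂ + A₃) := by ring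
        _ ≤ _ := hle (by omega)
    · rcases eq_or_ne j 1 with rfl | hj1
      · push_cast
        rw [mul_assoc]
        refine hs.trans ?_
        rw [pow_one]
        calc X ^ A₃ * (X ^ K * ε) / T = X ^ (A₃ + K) * ε / T := by rw [pow_add]; ring
          _ ≤ _ := by
            have := hle (show A₃ + K ≤ A₁ + A₂ + A₃ + K by omega)
            gcongr
      · push_cast
        rw [mul_assoc]
        refine (distInt_nat_mul_le _ _).trans ?_
        calc (s : ℝ) * distInt (Q * P.coeff j) ≤ X ^ A₃ * (X ^ (A₁ + A₂ + 1) * ε / T ^ j) :=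
              mul_le_mul hsA (hr' j (by omega)) (distInt_nonneg _) (by positivity)
          _ = X ^ (A₁ + A₂ + A₃ + 1) * ε / T ^ j := by ring
          _ ≤ _ := by
            have := hle (show A₁ + A₂ + A₃ + 1 ≤ A₁ + A₂ + A₃ + K by omega)
            gcongr

/-! ### Weyl sums -/

/-- The linear coefficient of a polynomial phase with a large exponential sum, given rational
approximations to the higher coefficients. -/
theorem distInt_coeff_one_of_large_sum (d e b : ℕ) : ∃ A : ℕ, ∀ (X T : ℝ) (P : ℝ[X])
    (I : Finset ℤ) (Q : ℕ), 2 ≤ X → X ^ A ≤ T → P.natDegree ≤ d + 1 →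
    (I : Set ℤ).OrdConnected → (∀ t ∈ I, |(t : ℝ)| ≤ X ^ e * T) →
    T ≤ X ^ e * ‖∑ t ∈ I, ShortIntervalTypeII.e (P.eval (t : ℝ))‖ → 1 ≤ Q → (Q : ℝ) ≤ X ^ b →
    (∀ j, 2 ≤ j → distInt (Q * P.coeff j) ≤ X ^ b / T ^ j) →
    distInt (Q * P.coeff 1) ≤ X ^ A / T := by
  set K₁ := 2 * (d + 1) + (e + 2) * (d + 1) + b with hK₁
  set K := K₁ + 2 * e + 7 with hK
  refine ⟨2 * e + 5 + K, fun X T P I Q hX hT hP hI hIb hsum hQ1 hQ hj => ?_⟩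
  have hX1 : 1 ≤ X := by linarith
  have hX0 : 0 < X := by linarith
  have hle : ∀ {i j : ℕ}, i ≤ j → X ^ i ≤ X ^ j := fun h => pow_le_pow_right₀ hX1 h
  have hT1 : 1 ≤ T := (one_le_pow₀ hX1).trans hT
  have hT0 : 0 < T := by linarith
  -- Progressions of `Y` terms with step `Q`: short enough for the terms of degree at least two to
  -- be almost constant modulo 1, yet long enough for the linear term to be detected.
  set Y := ⌊T / X ^ K⌋₊
  have hYle : (Y : ℝ) ≤ T / X ^ K := Nat.floor_le (by positivity)
  have hY1 : 1 ≤ Y := by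
    refine Nat.le_floor ?_
    rw [Nat.cast_one, one_le_div (by positivity)]
    exact (hle (by omega)).trans hT
  have hY1' : (1 : ℝ) ≤ Y := by exact_mod_cast hY1
  have hYge : T ≤ X ^ (K + 1) * Y := by
    have h1 : T / X ^ K < Y + 1 := Nat.lt_floor_add_one _
    rw [div_lt_iff₀ (by positivity)] at h1
    calc T ≤ 2 * Y * X ^ K := by
          refine h1.le.trans ?_
          gcongr; linarith
      _ ≤ X * Y * X ^ K := by gcongr
      _ = _ := by ring
  have hYT : (Y : ℝ) * X ^ K ≤ T := by rwa [le_div_iff₀ (by positivity)] at hYle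
  have hQY : (Q : ℝ) * Y ≤ T := by
    calc (Q : ℝ) * Y ≤ X ^ K * Y := by
          have := hQ.trans (hle (show b ≤ K by omega))
          gcongr
      _ ≤ T := by linarith
  have hXT : T ≤ X ^ e * T := le_mul_of_one_le_left hT0.le (one_le_pow₀ hX1)
  set R : ℤ := ⌊2 * (X ^ e * T)⌋
  have hR0 : 0 ≤ R := Int.floor_nonneg.2 (by linarith)
  have hR : (R : ℝ) ≤ 2 * (X ^ e * T) := Int.floor_le _
  set J := Finset.Icc (-R) R
  have hJcard : (J.card : ℝ) ≤ 8 * (X ^ e * T) := by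
    have : (J.card : ℤ) = 2 * R + 1 := by
      simp only [J, Int.card_Icc]; rw [Int.toNat_of_nonneg (by omega)]; ring
    have h2 : (J.card : ℝ) = 2 * R + 1 := by exact_mod_cast this
    rw [h2]; linarith
  -- Extension by zero makes the sum over `J` invariant under the shifts by `Qy`, since `QY ≤ T`.
  set F : ℤ → ℂ := fun t => if t ∈ I then ShortIntervalTypeII.e (P.eval (t : ℝ)) else 0
  have hshift : ∀ y ∈ Finset.range Y, ∑ t ∈ J, F (t + Q * y) =
      ∑ t ∈ I, ShortIntervalTypeII.e (P.eval (t : ℝ)) := by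
    intro y hy
    rw [Finset.mem_range] at hy
    rw [← Finset.sum_filter_add_sum_filter_not J (fun t : ℤ => t + Q * y ∈ I)]
    rw [Finset.sum_eq_zero (s := J.filter fun t : ℤ => ¬ t + Q * y ∈ I), add_zero]
    · refine Finset.sum_bij (fun t _ => t + Q * y) (fun t ht => (Finset.mem_filter.1 ht).2)
        (fun x _ z _ h => by simpa using h) (fun t ht => ⟨t - Q * y, ?_, by ring⟩)
        (fun t ht => by simp only [F]; rw [if_pos (Finset.mem_filter.1 ht).2])
      rw [Finset.mem_filter, sub_add_cancel]
      refine ⟨?_, ht⟩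
      have h1 := abs_le.1 (hIb t ht)
      have h2 : ((Q * y : ℕ) : ℝ) ≤ T := by
        refine le_trans ?_ hQY
        push_cast; gcongr
      push_cast at h2
      have h2' : (0 : ℝ) ≤ Q * y := by positivity
      have h3 : t - Q * y ≤ R := Int.le_floor.2 (by push_cast; linarith)
      have h4 : Q * y - t ≤ R := Int.le_floor.2 (by push_cast; linarith)
      rw [Finset.mem_Icc]; omega
    · intro t ht
      simp only [F]
      rw [if_neg (Finset.mem_filter.1 ht).2]
  have hswap : (Y : ℂ) * ∑ t ∈ I, ShortIntervalTypeII.e (P.eval (t : ℝ)) =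
      ∑ t ∈ J, ∑ y ∈ Finset.range Y, F (t + Q * y) := by
    rw [Finset.sum_comm, Finset.sum_congr rfl hshift]; simp
  obtain ⟨t, htJ, ht⟩ : ∃ t ∈ J, (Y : ℝ) ≤ X ^ (2 * e + 3) *
      ‖∑ y ∈ Finset.range Y, F (t + Q * y)‖ := by
    by_contra! hcon
    have h1 : (Y : ℝ) * T ≤ X ^ e * ∑ t ∈ J, ‖∑ y ∈ Finset.range Y, F (t + Q * y)‖ := by
      calc (Y : ℝ) * T ≤ Y * (X ^ e * ‖∑ t ∈ I, ShortIntervalTypeII.e (P.eval (t : ℝ))‖) := by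
            gcongr
        _ = X ^ e * ‖(Y : ℂ) * ∑ t ∈ I, ShortIntervalTypeII.e (P.eval (t : ℝ))‖ := by
            rw [norm_mul, Complex.norm_natCast]; ring
        _ ≤ _ := by
            rw [hswap]
            gcongr
            exact norm_sum_le _ _
    have hJne : J.Nonempty := ⟨0, by rw [Finset.mem_Icc]; omega⟩
    have h2 : X ^ (2 * e + 3) * ∑ t ∈ J, ‖∑ y ∈ Finset.range Y, F (t + Q * y)‖ <
        J.card * Y := by
      rw [Finset.mul_sum, ← nsmul_eq_mul, ← Finset.sum_const]
      exact Finset.sum_lt_sum_of_nonempty hJne hcon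
    have h8 : (8 : ℝ) ≤ X ^ 3 := by
      calc (8 : ℝ) = 2 ^ 3 := by norm_num
        _ ≤ X ^ 3 := by gcongr
    have h3 : (J.card : ℝ) * Y ≤ X ^ (e + 3) * (Y * T) := by
      calc (J.card : ℝ) * Y ≤ 8 * (X ^ e * T) * Y := by gcongr
        _ ≤ X ^ 3 * (X ^ e * T) * Y := by gcongr
        _ = _ := by ring
    have h4 : X ^ (e + 3) * (Y * T) ≤
        X ^ (2 * e + 3) * ∑ t ∈ J, ‖∑ y ∈ Finset.range Y, F (t + Q * y)‖ := by
      calc X ^ (e + 3) * (Y * T) ≤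
            X ^ (e + 3) * (X ^ e * ∑ t ∈ J, ‖∑ y ∈ Finset.range Y, F (t + Q * y)‖) := by gcongr
        _ = _ := by ring
    linarith
  have htR : |(t : ℝ)| ≤ 2 * (X ^ e * T) := by
    have := Finset.mem_Icc.1 htJ
    refine le_trans ?_ hR
    rw [abs_le]; exact ⟨by exact_mod_cast this.1, by exact_mod_cast this.2⟩
  set W := (Finset.range Y).filter fun y : ℕ => t + Q * y ∈ I
  have hV : ∑ y ∈ Finset.range Y, F (t + Q * y) =
      ∑ y ∈ W, ShortIntervalTypeII.e (P.eval ((t + Q * y : ℤ) : ℝ)) := by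
    simp only [F, W, Finset.sum_filter]
  rw [hV] at ht
  -- With `u = t + Qy` one has `u^i - t^i = Qy` times an integer of order `T^(i-1)`. So the term of
  -- degree `i` is an integer multiple of `Q c_i`, and its distance to the integers is of order `Y
  -- T^(i-1) / T^i = Y/T`, up to powers of `X`.
  have happrox : ∀ y ∈ W, ‖ShortIntervalTypeII.e (P.eval ((t + Q * y : ℤ) : ℝ)) -
      ShortIntervalTypeII.e (P.eval (t : ℝ) + Q * P.coeff 1 * y)‖ ≤ 7 * (X ^ K₁ / X ^ K) := by
    intro y hy
    have hyY : (y : ℝ) ≤ Y := by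
      exact_mod_cast (Finset.mem_range.1 (Finset.mem_filter.1 hy).1).le
    refine (norm_e_sub_e_le _ _).trans ?_
    refine mul_le_mul_of_nonneg_left ?_ (by norm_num)
    set u : ℤ := t + Q * y
    have hu : |(u : ℝ)| ≤ X ^ (e + 2) * T := by
      simp only [u]; push_cast
      refine (abs_add_le _ _).trans ?_
      have : |(Q : ℝ) * y| ≤ T := by
        rw [abs_of_nonneg (by positivity)]
        exact le_trans (by gcongr) hQY
      have h4 : (4 : ℝ) ≤ X ^ 2 := by nlinarith
      calc |(t : ℝ)| + |(Q : ℝ) * y| ≤ 4 * (X ^ e * T) := by linarith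
        _ ≤ X ^ 2 * (X ^ e * T) := by gcongr
        _ = _ := by ring
    have ht' : |(t : ℝ)| ≤ X ^ (e + 2) * T := by
      refine htR.trans ?_
      have h4 : (2 : ℝ) ≤ X ^ 2 := by nlinarith
      calc 2 * (X ^ e * T) ≤ X ^ 2 * (X ^ e * T) := by gcongr
        _ = _ := by ring
    have heq : P.eval (u : ℝ) - (P.eval (t : ℝ) + Q * P.coeff 1 * y) =
        ∑ i ∈ Finset.Icc 2 (d + 1),
          ((y * ∑ k ∈ Finset.range i, u ^ k * t ^ (i - 1 - k) : ℤ) : ℝ) * (Q * P.coeff i) := by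
      have h1 := coeff_one_mul_sub hP (u : ℝ) (t : ℝ)
      have h2 : (u : ℝ) - t = Q * y := by simp only [u]; push_cast; ring
      have h3 : ∀ i ∈ Finset.Icc 2 (d + 1), ((u : ℝ) ^ i - (t : ℝ) ^ i) * P.coeff i =
          ((y * ∑ k ∈ Finset.range i, u ^ k * t ^ (i - 1 - k) : ℤ) : ℝ) * (Q * P.coeff i) := by
        intro i _
        rw [← geom_sum₂_mul, h2]; push_cast; ring
      rw [Finset.sum_congr rfl h3, h2] at h1
      linarith
    rw [heq]
    refine (distInt_sum_le _ _).trans ?_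
    refine (Finset.sum_le_card_nsmul _ _
      (Y * ((d + 1) * X ^ ((e + 2) * (d + 1)) * X ^ b / T)) fun i hi => ?_).trans ?_
    · rw [Finset.mem_Icc] at hi
      refine (distInt_int_mul_le _ _).trans ?_
      have h3 : |((y * ∑ k ∈ Finset.range i, u ^ k * t ^ (i - 1 - k) : ℤ) : ℝ)| ≤
          Y * (i * (X ^ (e + 2) * T) ^ (i - 1)) := by
        push_cast
        rw [abs_mul, Nat.abs_cast]
        gcongr
        refine (Finset.abs_sum_le_sum_abs _ _).trans ?_
        refine (Finset.sum_le_card_nsmul _ _ ((X ^ (e + 2) * T) ^ (i - 1))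
          fun k hk => ?_).trans_eq (by simp)
        rw [Finset.mem_range] at hk
        rw [abs_mul, abs_pow, abs_pow]
        calc |(u : ℝ)| ^ k * |(t : ℝ)| ^ (i - 1 - k) ≤
            (X ^ (e + 2) * T) ^ k * (X ^ (e + 2) * T) ^ (i - 1 - k) := by gcongr
          _ = _ := by rw [← pow_add]; congr 1; omega
      have hTi : T ^ i = T ^ (i - 1) * T := by rw [← pow_succ]; congr 1; omega
      have hid : (i : ℝ) ≤ d + 1 := by exact_mod_cast hi.2
      calc _ ≤ Y * (i * (X ^ (e + 2) * T) ^ (i - 1)) * (X ^ b / T ^ i) :=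
            mul_le_mul h3 (hj i hi.1) (distInt_nonneg _) (by positivity)
        _ = Y * (i * X ^ ((e + 2) * (i - 1)) * X ^ b / T) := by
            rw [mul_pow, pow_mul, hTi]; field_simp
        _ ≤ _ := by
            have := hle (Nat.mul_le_mul_left (e + 2) (show i - 1 ≤ d + 1 by omega))
            gcongr
    · rw [nsmul_eq_mul]
      have hc : ((Finset.Icc 2 (d + 1)).card : ℝ) ≤ X ^ (d + 1) := by
        refine le_trans ?_ (natCast_le_pow hX (d + 1))
        rw [Nat.card_Icc]
        exact_mod_cast (by omega : d + 1 + 1 - 2 ≤ d + 1)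
      have hd := natCast_le_pow hX (d + 1)
      push_cast at hd
      calc _ ≤ X ^ (d + 1) * (Y * (X ^ (d + 1) * X ^ ((e + 2) * (d + 1)) * X ^ b / T)) := by
            gcongr
        _ = X ^ K₁ * (Y / T) := by rw [hK₁, pow_add, pow_add, two_mul, pow_add]; ring
        _ ≤ X ^ K₁ * (1 / X ^ K) := by
            gcongr X ^ K₁ * ?_
            rw [div_le_div_iff₀ hT0 (by positivity)]; linarith
        _ = _ := by ring
  have hV' : (Y : ℝ) ≤ X ^ (2 * e + 4) *
      ‖∑ y ∈ W, ShortIntervalTypeII.e (Q * P.coeff 1 * y)‖ := by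
    have h1 : ‖∑ y ∈ W, ShortIntervalTypeII.e (P.eval ((t + Q * y : ℤ) : ℝ)) -
        ∑ y ∈ W, ShortIntervalTypeII.e (P.eval (t : ℝ) + Q * P.coeff 1 * y)‖ ≤
        Y * (7 * (X ^ K₁ / X ^ K)) := by
      rw [← Finset.sum_sub_distrib]
      refine (norm_sum_le _ _).trans ((Finset.sum_le_card_nsmul _ _ _ happrox).trans ?_)
      rw [nsmul_eq_mul]
      gcongr
      exact_mod_cast (Finset.card_filter_le _ _).trans_eq (Finset.card_range _)
    have h2 : ‖∑ y ∈ W, ShortIntervalTypeII.e (P.eval (t : ℝ) + Q * P.coeff 1 * y)‖ =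
        ‖∑ y ∈ W, ShortIntervalTypeII.e (Q * P.coeff 1 * y)‖ := by
      simp_rw [e_add]
      rw [← Finset.mul_sum, norm_mul, norm_e, one_mul]
    have h3 := norm_le_norm_add_norm_sub
      (∑ y ∈ W, ShortIntervalTypeII.e (P.eval (t : ℝ) + Q * P.coeff 1 * y))
      (∑ y ∈ W, ShortIntervalTypeII.e (P.eval ((t + Q * y : ℤ) : ℝ)))
    rw [norm_sub_rev, h2] at h3
    have h16 : (16 : ℝ) ≤ X ^ 4 := by
      calc (16 : ℝ) = 2 ^ 4 := by norm_num
        _ ≤ X ^ 4 := by gcongr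
    have h5 : X ^ (2 * e + 3) * (Y * (7 * (X ^ K₁ / X ^ K))) ≤ Y / 2 := by
      have : X ^ K = X ^ K₁ * X ^ (2 * e + 3) * X ^ 4 := by rw [hK]; ring
      rw [this]
      have : X ^ (2 * e + 3) * (Y * (7 * (X ^ K₁ / (X ^ K₁ * X ^ (2 * e + 3) * X ^ 4)))) =
          Y * (7 / X ^ 4) := by field_simp
      rw [this]
      have : 7 / X ^ 4 ≤ 1 / 2 := by
        rw [div_le_div_iff₀ (by positivity) (by norm_num)]; linarith
      nlinarith
    have h6 : (Y : ℝ) ≤ X ^ (2 * e + 3) *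
        (‖∑ y ∈ W, ShortIntervalTypeII.e (Q * P.coeff 1 * y)‖ + Y * (7 * (X ^ K₁ / X ^ K))) :=
      ht.trans (by gcongr; linarith)
    have h7 : (Y : ℝ) ≤ 2 * (X ^ (2 * e + 3) *
        ‖∑ y ∈ W, ShortIntervalTypeII.e (Q * P.coeff 1 * y)‖) := by linarith
    calc (Y : ℝ) ≤ X * (X ^ (2 * e + 3) *
        ‖∑ y ∈ W, ShortIntervalTypeII.e (Q * P.coeff 1 * y)‖) := h7.trans (by gcongr)
      _ = _ := by ring
  have hWne : W.Nonempty := by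
    rw [Finset.nonempty_iff_ne_empty]
    intro h
    rw [h] at hV'; simp at hV'; omega
  -- Order-connectedness of `I` makes the admissible `y` consecutive, so the linear phase sums to a
  -- geometric series.
  have hW : W = Finset.Ico (W.min' hWne) (W.max' hWne + 1) := by
    ext y
    rw [Finset.mem_Ico, Nat.lt_succ_iff]
    refine ⟨fun hy => ⟨W.min'_le _ hy, W.le_max' _ hy⟩, fun ⟨h1, h2⟩ => ?_⟩
    have h3 := Finset.mem_filter.1 (W.min'_mem hWne)
    have h4 := Finset.mem_filter.1 (W.max'_mem hWne)
    refine Finset.mem_filter.2 ⟨?_, ?_⟩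
    · rw [Finset.mem_range] at h4 ⊢; omega
    · refine hI.out h3.2 h4.2 ⟨?_, ?_⟩
      · have : (W.min' hWne : ℤ) ≤ y := by exact_mod_cast h1
        have := mul_le_mul_of_nonneg_left this (show (0 : ℤ) ≤ Q by positivity)
        linarith
      · have : (y : ℤ) ≤ W.max' hWne := by exact_mod_cast h2
        have := mul_le_mul_of_nonneg_left this (show (0 : ℤ) ≤ Q by positivity)
        linarith
  rw [hW, Finset.sum_Ico_eq_sum_range] at hV'
  have hg := norm_geom_sum_e_le (Q * P.coeff 1) (W.min' hWne)
    (W.max' hWne + 1 - W.min' hWne)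
  push_cast at hV' hg
  set V := ‖∑ i ∈ Finset.range (W.max' hWne + 1 - W.min' hWne),
    ShortIntervalTypeII.e (Q * P.coeff 1 * (W.min' hWne + i))‖
  have hV0 : 0 ≤ V := norm_nonneg _
  have hd0 := distInt_nonneg (Q * P.coeff 1)
  rw [le_div_iff₀ hT0]
  calc distInt (Q * P.coeff 1) * T ≤
      distInt (Q * P.coeff 1) * (X ^ (K + 1) * (X ^ (2 * e + 4) * V)) := by
        gcongr; exact hYge.trans (by gcongr)
    _ = X ^ (2 * e + 5 + K) * (distInt (Q * P.coeff 1) * V) := by ring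
    _ ≤ X ^ (2 * e + 5 + K) * 1 := by
        gcongr
        nlinarith [mul_nonneg hd0 hV0]
    _ = _ := mul_one _

/-- Van der Corput differencing. -/
theorem exists_differences_large_sum (e : ℕ) {X T : ℝ} (hX : 2 ≤ X) (hT : 1 ≤ T) (P : ℝ[X])
    (I : Finset ℤ) (hI : ∀ t ∈ I, |(t : ℝ)| ≤ X ^ e * T)
    (hsum : T ≤ X ^ e * ‖∑ t ∈ I, ShortIntervalTypeII.e (P.eval (t : ℝ))‖) :
    ∃ D : Finset ℤ, (∀ r ∈ D, |(r : ℝ)| ≤ X ^ (e + 1) * T) ∧ T ≤ X ^ (4 * e + 7) * D.card ∧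
      ∀ r ∈ D, T ≤ X ^ (4 * e + 7) * ‖∑ t ∈ I.filter fun t => t + r ∈ I,
        ShortIntervalTypeII.e ((taylor (r : ℝ) P - P).eval (t : ℝ))‖ := by
  have hX1 : 1 ≤ X := by linarith
  have hX0 : 0 < X := by linarith
  set R : ℤ := ⌊2 * (X ^ e * T)⌋
  have hXT : 1 ≤ X ^ e * T := one_le_mul_of_one_le_of_one_le (one_le_pow₀ hX1) hT
  have hTX : T ≤ X ^ e * T := le_mul_of_one_le_left (by linarith) (one_le_pow₀ hX1)
  have hR0 : 0 ≤ R := Int.floor_nonneg.2 (by linarith)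
  have hR : (R : ℝ) ≤ 2 * (X ^ e * T) := Int.floor_le _
  have hR' : 2 * (X ^ e * T) < R + 1 := Int.lt_floor_add_one _
  set D₀ := Finset.Icc (-R) R with hD₀def
  have hD₀ : (D₀.card : ℝ) = 2 * R + 1 := by
    have : (D₀.card : ℤ) = 2 * R + 1 := by
      simp only [D₀, Int.card_Icc]; rw [Int.toNat_of_nonneg (by omega)]; ring
    exact_mod_cast this
  have hdiff : ∀ h ∈ I, ∀ h' ∈ I, h' - h ∈ D₀ := by
    intro h hh h' hh'
    have h1 := abs_le.1 (hI h hh)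
    have h2 := abs_le.1 (hI h' hh')
    have h3 : h' - h ≤ R := Int.le_floor.2 (by push_cast; linarith)
    have h4 : h - h' ≤ R := Int.le_floor.2 (by push_cast; linarith)
    rw [Finset.mem_Icc]; omega
  have hIcard : (I.card : ℝ) ≤ 8 * (X ^ e * T) := by
    have : I.card ≤ D₀.card := by
      refine Finset.card_le_card fun t ht => ?_
      have h1 := abs_le.1 (hI t ht)
      have h3 : t ≤ R := Int.le_floor.2 (by linarith)
      have h4 : - t ≤ R := Int.le_floor.2 (by push_cast; linarith)
      rw [Finset.mem_Icc]; omega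
    have : (I.card : ℝ) ≤ D₀.card := by exact_mod_cast this
    linarith
  set f : ℤ → ℝ := fun r => ‖∑ t ∈ I.filter fun t => t + r ∈ I,
    ShortIntervalTypeII.e ((taylor (r : ℝ) P - P).eval (t : ℝ))‖ with hf
  have hfle : ∀ r ∈ D₀, f r ≤ 8 * (X ^ e * T) := by
    intro r _
    refine (norm_sum_le _ _).trans ?_
    simp only [norm_e, Finset.sum_const, nsmul_eq_mul, mul_one]
    refine le_trans ?_ hIcard
    exact_mod_cast Finset.card_filter_le _ _
  have hsq : ‖∑ t ∈ I, ShortIntervalTypeII.e (P.eval (t : ℝ))‖ ^ 2 ≤ ∑ r ∈ D₀, f r := by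
    have h1 : (∑ t ∈ I, ShortIntervalTypeII.e (P.eval (t : ℝ))) *
        (starRingEnd ℂ) (∑ t ∈ I, ShortIntervalTypeII.e (P.eval (t : ℝ))) =
        ∑ r ∈ D₀, ∑ t ∈ I.filter fun t => t + r ∈ I,
          ShortIntervalTypeII.e ((taylor (r : ℝ) P - P).eval (t : ℝ)) := by
      rw [map_sum, mul_comm, Finset.sum_mul_sum]
      simp_rw [Finset.sum_filter]
      rw [Finset.sum_comm]
      conv_rhs => rw [Finset.sum_comm]
      rw [Finset.sum_comm]
      refine Finset.sum_congr rfl fun x hx => ?_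
      rw [← Finset.sum_filter]
      refine Finset.sum_bij (fun y _ => y - x)
        (fun y hy => Finset.mem_filter.2 ⟨hdiff x hx y hy, by simpa using hy⟩)
        (fun y _ z _ h => by simpa using h)
        (fun r hr => ⟨x + r, (Finset.mem_filter.1 hr).2, by ring⟩) (fun y hy => ?_)
      rw [eval_sub, taylor_eval, e_sub, mul_comm]
      congr 3
      push_cast; ring
    have h2 := congrArg norm h1
    rw [norm_mul, RCLike.norm_conj, ← sq] at h2
    rw [h2]
    exact norm_sum_le _ _
  have h64 : (64 : ℝ) ≤ X ^ 6 := by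
    calc (64 : ℝ) = 2 ^ 6 := by norm_num
      _ ≤ X ^ 6 := by gcongr
  have hpop := card_le_mul_card_popular D₀ f (B := 8 * (X ^ e * T)) (Y := X ^ (4 * e + 6))
    (by positivity) (by positivity) hfle (by
      calc (D₀.card : ℝ) * (8 * (X ^ e * T)) ≤ 8 * (X ^ e * T) * (8 * (X ^ e * T)) := by
            gcongr; rw [hD₀]; linarith
        _ = 64 * X ^ (2 * e) * T ^ 2 := by ring
        _ ≤ X ^ 6 * X ^ (2 * e) *
            (X ^ e * ‖∑ t ∈ I, ShortIntervalTypeII.e (P.eval (t : ℝ))‖) ^ 2 := by gcongr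
        _ = X ^ (4 * e + 6) * ‖∑ t ∈ I, ShortIntervalTypeII.e (P.eval (t : ℝ))‖ ^ 2 := by ring
        _ ≤ _ := by gcongr)
  have h2Y : ∀ z : ℝ, 0 ≤ z → 2 * X ^ (4 * e + 6) * z ≤ X ^ (4 * e + 7) * z := by
    intro z hz
    have e1 : X ^ (4 * e + 7) * z = X * X ^ (4 * e + 6) * z := by ring
    rw [e1]; gcongr
  obtain ⟨D, hD⟩ : ∃ D, D = D₀.filter fun r =>
    8 * (X ^ e * T) ≤ 2 * X ^ (4 * e + 6) * f r := ⟨_, rfl⟩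
  rw [← hD] at hpop
  refine ⟨D, fun r hr => ?_, ?_, fun r hr => ?_⟩
  · rw [hD] at hr
    have := Finset.mem_Icc.1 (Finset.mem_filter.1 hr).1
    have h1 : |(r : ℝ)| ≤ R := by
      rw [abs_le]; exact ⟨by exact_mod_cast this.1, by exact_mod_cast this.2⟩
    calc |(r : ℝ)| ≤ 2 * (X ^ e * T) := h1.trans hR
      _ ≤ X * (X ^ e * T) := by gcongr
      _ = _ := by ring
  · refine le_trans ?_ (hpop.trans (h2Y _ (Nat.cast_nonneg _)))
    rw [hD₀]; linarith
  · rw [hD] at hr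
    refine le_trans ?_ ((Finset.mem_filter.1 hr).2.trans (h2Y _ (norm_nonneg _)))
    linarith

/-- Weyl's inequality: a polynomial phase with a large exponential sum over an interval has
coefficients close to rationals with a small common denominator. -/
theorem weyl_inequality (d : ℕ) : ∀ e : ℕ, ∃ A : ℕ, ∀ (X T : ℝ) (P : ℝ[X]) (I : Finset ℤ),
    2 ≤ X → 1 ≤ T → P.natDegree ≤ d → (I : Set ℤ).OrdConnected →
    (∀ t ∈ I, |(t : ℝ)| ≤ X ^ e * T) →
    T ≤ X ^ e * ‖∑ t ∈ I, ShortIntervalTypeII.e (P.eval (t : ℝ))‖ →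
    ∃ q : ℕ, 1 ≤ q ∧ (q : ℝ) ≤ X ^ A ∧
      ∀ j, 1 ≤ j → distInt (q * P.coeff j) ≤ X ^ A / T ^ j := by
  induction d with
  | zero =>
    refine fun e => ⟨0, fun X T P I hX hT hP _ _ _ => ⟨1, le_rfl, by simp, fun j hj => ?_⟩⟩
    rw [coeff_eq_zero_of_natDegree_lt (by omega)]
    simp only [mul_zero, distInt_zero]
    positivity
  | succ d ih =>
    intro e
    obtain ⟨A₁, hA₁⟩ := ih (4 * e + 7)
    obtain ⟨A₂, hA₂⟩ := coeff_of_taylor_sub (d + 1) (4 * e + 7 + A₁) (d + 1)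
    obtain ⟨A₃, hA₃⟩ := distInt_coeff_one_of_large_sum d e (A₁ + A₂)
    set K := A₁ + A₂ + A₃
    refine ⟨K * (d + 1), fun X T P I hX hT hP hI hIb hsum => ?_⟩
    have hX1 : 1 ≤ X := by linarith
    have hX0 : 0 < X := by linarith
    have hle : ∀ {i j : ℕ}, i ≤ j → X ^ i ≤ X ^ j := fun h => pow_le_pow_right₀ hX1 h
    have hT0 : 0 < T := by linarith
    have hKd : K ≤ K * (d + 1) := Nat.le_mul_of_pos_right _ (by omega)
    -- For small `T` the choice `q = 1` works trivially, as `T^j ≤ X^(K(d+1))` for `j ≤ d+1`. This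
    -- is the source of the exponent `K(d+1)`.
    rcases lt_or_ge T (X ^ K) with hTK | hTK
    · refine ⟨1, le_rfl, by simpa using one_le_pow₀ hX1, fun j hj => ?_⟩
      rcases lt_or_ge (d + 1) j with hjd | hjd
      · rw [coeff_eq_zero_of_natDegree_lt (by omega)]
        simp only [mul_zero, distInt_zero]
        positivity
      · refine (distInt_le_half _).trans ?_
        rw [le_div_iff₀ (by positivity)]
        calc 1 / 2 * T ^ j ≤ 1 * (X ^ K) ^ j := by gcongr; norm_num
          _ = X ^ (K * j) := by rw [one_mul, pow_mul]
          _ ≤ _ := hle (Nat.mul_le_mul_left K hjd)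
    obtain ⟨D, hD, hDcard, hDlarge⟩ := exists_differences_large_sum e hX hT P I hIb hsum
    -- The differenced phase has degree at most `d`, and the range `I ∩ (I - r)` is again an
    -- interval, so the induction hypothesis applies.
    have hstep : ∀ r ∈ D, ∃ q : ℕ, 1 ≤ q ∧ (q : ℝ) ≤ X ^ A₁ ∧ ∀ j, 1 ≤ j →
        distInt (q * (taylor (r : ℝ) P - P).coeff j) ≤ X ^ A₁ / T ^ j := by
      intro r hr
      refine hA₁ X T _ (I.filter fun t => t + r ∈ I) hX hT (natDegree_taylor_sub_le hP r) ?_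
        (fun t ht => ?_) (hDlarge r hr)
      · refine ⟨fun x hx y hy z hz => ?_⟩
        simp only [Finset.coe_filter, Set.mem_ofPred_eq] at hx hy ⊢
        exact ⟨hI.out hx.1 hy.1 hz, hI.out hx.2 hy.2 ⟨by linarith [hz.1], by linarith [hz.2]⟩⟩
      · refine (hIb t (Finset.mem_filter.1 ht).1).trans ?_
        have := hle (show e ≤ 4 * e + 7 by omega)
        gcongr
    obtain ⟨q, hq1, hqA, D', hD'D, hD'card, hD'⟩ :=
      exists_common_nat D (one_le_pow₀ hX1) _ hstep
    obtain ⟨r, hr1, hrA, hr⟩ := hA₂ X T (X ^ A₁) P q D' hX ((hle (by omega)).trans hTK)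
      (by positivity) (by rw [← pow_add]; exact (hle (by omega)).trans hTK) hP
      (fun h hh => by
        refine (hD h (hD'D hh)).trans ?_
        have := hle (show e + 1 ≤ 4 * e + 7 + A₁ by omega)
        gcongr)
      (by
        rw [pow_add _ (4 * e + 7), mul_assoc]
        refine hDcard.trans ?_
        gcongr) hD'
    have hr' : ∀ j, 2 ≤ j → distInt ((r * q : ℕ) * P.coeff j) ≤ X ^ (A₁ + A₂) / T ^ j := by
      intro j hj
      push_cast
      refine (hr j hj (by omega)).trans_eq ?_
      rw [← pow_add, add_comm]
    have hrq : ((r * q : ℕ) : ℝ) ≤ X ^ (A₁ + A₂) := by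
      push_cast
      calc (r : ℝ) * q ≤ X ^ A₂ * X ^ A₁ := by gcongr
        _ = _ := by ring
    have hrq1 : 1 ≤ r * q := Nat.mul_pos hr1 hq1
    have h1 := hA₃ X T P I (r * q) hX ((hle (by omega)).trans hTK) hP hI hIb hsum hrq1 hrq hr'
    refine ⟨r * q, hrq1, hrq.trans (hle (by omega)), fun j hj => ?_⟩
    rcases eq_or_ne j 1 with rfl | hj1
    · rw [pow_one]
      refine h1.trans ?_
      have := hle (show A₃ ≤ K * (d + 1) by omega)
      gcongr
    · refine (hr' j (by omega)).trans ?_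
      have := hle (show A₁ + A₂ ≤ K * (d + 1) by omega)
      gcongr

/-! ### Divisor functions and their moments -/

theorem tau_succ (r n : ℕ) :
    tau (r + 1) n = ∑ p ∈ n.divisorsAntidiagonal, tau r p.2 := by
  classical
  rw [tau, Finset.card_eq_sum_card_fiberwise (t := n.divisorsAntidiagonal)
    (f := fun f => (f 0, ∏ i : Fin r, f i.succ))]
  · refine Finset.sum_congr rfl fun p hp => ?_
    rw [Nat.mem_divisorsAntidiagonal] at hp
    refine Finset.card_bij (fun f _ => Fin.tail f) (fun f hf => ?_) (fun f hf g hg h => ?_)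
      (fun f hf => ⟨Fin.cons p.1 f, ?_, by simp⟩)
    · rw [Finset.mem_filter] at hf
      rw [Nat.mem_finMulAntidiag]
      refine ⟨?_, fun h0 => hp.2 (by rw [← hp.1, h0, mul_zero])⟩
      rw [← hf.2]; rfl
    · rw [Finset.mem_filter] at hf hg
      have h0 : f 0 = g 0 := by
        have h1 := congrArg Prod.fst hf.2
        have h2 := congrArg Prod.fst hg.2
        exact h1.trans h2.symm
      rw [← Fin.cons_self_tail f, ← Fin.cons_self_tail g, h, h0]
    · rw [Nat.mem_finMulAntidiag] at hf
      rw [Finset.mem_filter, Nat.mem_finMulAntidiag, Fin.prod_univ_succ]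
      simp [hf.1, hp.1, hp.2]
  · intro f hf
    have hf := Nat.mem_finMulAntidiag.1 hf
    rw [Fin.prod_univ_succ] at hf
    exact Nat.mem_divisorsAntidiagonal.2 hf

/-- Splitting off one factor is Dirichlet convolution with `ζ`; the other recursions then follow
from the laws of powers. -/
theorem tau_eq_zeta_pow (r n : ℕ) : tau r n = (ArithmeticFunction.zeta ^ r) n := by
  induction r generalizing n with
  | zero =>
    rw [pow_zero, ArithmeticFunction.one_apply]
    split_ifs with h
    · rw [h, tau, Nat.finMulAntidiag_one, Finset.card_singleton]
    · rw [tau, Nat.finMulAntidiag_zero_left h, Finset.card_empty]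
  | succ r ih =>
    rw [tau_succ, pow_succ', ArithmeticFunction.mul_apply]
    refine Finset.sum_congr rfl fun p hp => ?_
    rw [ArithmeticFunction.zeta_apply_ne
      (Nat.ne_zero_of_mem_divisorsAntidiagonal hp).1, one_mul, ih]

theorem tau_one_right (r : ℕ) : tau r 1 = 1 := by
  rw [tau, Nat.finMulAntidiag_one, Finset.card_singleton]

theorem tau_zero_left (n : ℕ) : tau 0 n = if n = 1 then 1 else 0 := by
  rw [tau_eq_zeta_pow, pow_zero, ArithmeticFunction.one_apply]

theorem tau_succ_eq_sum_divisors (r n : ℕ) : tau (r + 1) n = ∑ d ∈ n.divisors, tau r d := by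
  rw [tau_eq_zeta_pow, pow_succ, ArithmeticFunction.mul_zeta_apply]
  simp_rw [tau_eq_zeta_pow]

theorem tau_add (r s n : ℕ) :
    tau (r + s) n = ∑ p ∈ n.divisorsAntidiagonal, tau r p.1 * tau s p.2 := by
  rw [tau_eq_zeta_pow, pow_add, ArithmeticFunction.mul_apply]
  simp_rw [tau_eq_zeta_pow]

/-- Every divisor of `ab` is a product of a divisor of `a` and one of `b`, possibly in several ways;
induction on `s`. -/
theorem tau_mul_le (s a b : ℕ) : tau s (a * b) ≤ tau s a * tau s b := by
  induction s generalizing a b with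
  | zero =>
    simp only [tau_zero_left, mul_eq_one]
    split_ifs <;> simp_all
  | succ s ih =>
    simp_rw [tau_succ_eq_sum_divisors, Nat.divisors_mul, Finset.sum_mul_sum]
    rw [← Finset.sum_product', Finset.mul_def]
    refine (Finset.sum_image_le_of_nonneg ?_).trans (Finset.sum_le_sum fun p _ => ih p.1 p.2)
    intros; positivity

/-- In `∑ τ_r(d) τ_s(n)` over `n = d d'`, submultiplicativity replaces `τ_s(n)` by `τ_s(d) τ_s(d')`,
and induction replaces `τ_r(d) τ_s(d)` by `τ_{rs}(d)`. Powers of divisor functions thus reduce to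
first moments of a longer one. -/
theorem tau_mul_tau_le (r s n : ℕ) : tau r n * tau s n ≤ tau (r * s) n := by
  induction r generalizing n with
  | zero =>
    rw [zero_mul, tau_zero_left]
    split_ifs with h
    · rw [h, tau_one_right]
    · simp
  | succ r ih =>
    rw [add_one_mul, tau_add, tau_add, Finset.sum_mul]
    refine Finset.sum_le_sum fun p hp => ?_
    rw [← (Nat.mem_divisorsAntidiagonal.1 hp).1]
    have h1 : tau 1 p.2 = 1 := by
      rw [tau_eq_zeta_pow, pow_one, ArithmeticFunction.zeta_apply_ne
        (Nat.ne_zero_of_mem_divisorsAntidiagonal hp).2]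
    calc tau r p.1 * tau 1 p.2 * tau s (p.1 * p.2)
        ≤ tau r p.1 * 1 * (tau s p.1 * tau s p.2) := by
          rw [h1]; gcongr; exact tau_mul_le _ _ _
      _ = tau r p.1 * tau s p.1 * tau s p.2 := by ring
      _ ≤ _ := by gcongr; exact ih _

/-- Summing over one factor `d` leaves the range `N/d`; each extra factor costs a harmonic sum,
hence one logarithm. -/
theorem sum_tau_succ_le (r N : ℕ) :
    ((∑ n ∈ Finset.Ioc 0 N, tau (r + 1) n : ℕ) : ℝ) ≤ N * (1 + Real.log N) ^ r := by
  induction r generalizing N with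
  | zero =>
    have : ∀ n ∈ Finset.Ioc 0 N, tau (0 + 1) n = 1 := by
      intro n hn
      rw [zero_add, tau_eq_zeta_pow, pow_one, ArithmeticFunction.zeta_apply_ne
        (Finset.mem_Ioc.1 hn).1.ne']
    rw [Finset.sum_congr rfl this]; simp
  | succ r ih =>
    rcases N.eq_zero_or_pos with rfl | hN
    · simp
    have hN1 : (1 : ℝ) ≤ N := by exact_mod_cast hN
    have hlog : 0 ≤ Real.log N := Real.log_nonneg hN1
    have h1 : ∑ n ∈ Finset.Ioc 0 N, tau (r + 1 + 1) n =
        ∑ d ∈ Finset.Ioc 0 N, ∑ m ∈ Finset.Ioc 0 (N / d), tau (r + 1) m := by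
      simp_rw [tau_eq_zeta_pow _, pow_succ' _ (r + 1)]
      rw [ArithmeticFunction.sum_Ioc_mul_eq_sum_sum]
      refine Finset.sum_congr rfl fun d hd => ?_
      rw [ArithmeticFunction.zeta_apply_ne (Finset.mem_Ioc.1 hd).1.ne', one_mul]
    have h2 : ∀ d ∈ Finset.Ioc 0 N, ((∑ m ∈ Finset.Ioc 0 (N / d), tau (r + 1) m : ℕ) : ℝ) ≤
        N * (1 + Real.log N) ^ r * (d : ℝ)⁻¹ := by
      intro d hd
      rw [Finset.mem_Ioc] at hd
      have hNd : 1 ≤ N / d := Nat.div_pos hd.2 hd.1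
      have hNd1 : (1 : ℝ) ≤ (N / d : ℕ) := by exact_mod_cast hNd
      calc _ ≤ ((N / d : ℕ) : ℝ) * (1 + Real.log (N / d : ℕ)) ^ r := ih _
        _ ≤ (N / d) * (1 + Real.log N) ^ r := by
            have := Real.log_nonneg hNd1
            gcongr
            · exact Nat.cast_div_le
            · exact Nat.div_le_self _ _
        _ = _ := by ring
    have h3 : ∑ d ∈ Finset.Ioc 0 N, (d : ℝ)⁻¹ ≤ 1 + Real.log N := by
      have := harmonic_le_one_add_log N
      rw [harmonic_eq_sum_Icc] at this
      push_cast at this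
      exact this
    rw [h1]
    push_cast at h2 ⊢
    calc _ ≤ ∑ d ∈ Finset.Ioc 0 N, N * (1 + Real.log N) ^ r * (d : ℝ)⁻¹ :=
          Finset.sum_le_sum h2
      _ = N * (1 + Real.log N) ^ r * ∑ d ∈ Finset.Ioc 0 N, (d : ℝ)⁻¹ := by
          rw [Finset.mul_sum]
      _ ≤ N * (1 + Real.log N) ^ r * (1 + Real.log N) := by gcongr
      _ = _ := by ring

theorem sum_tau_five_sq_le (N : ℕ) :
    ∑ n ∈ Finset.Ioc 0 N, (tau 5 n : ℝ) ^ 2 ≤ N * (1 + Real.log N) ^ 24 := by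
  refine le_trans ?_ (sum_tau_succ_le 24 N)
  push_cast
  refine Finset.sum_le_sum fun n _ => ?_
  have := tau_mul_tau_le 5 5 n
  rw [sq]; exact_mod_cast this

theorem sum_tau_three_pow_four_le (N : ℕ) :
    ∑ n ∈ Finset.Ioc 0 N, (tau 3 n : ℝ) ^ 4 ≤ N * (1 + Real.log N) ^ 80 := by
  refine le_trans ?_ (sum_tau_succ_le 80 N)
  push_cast
  refine Finset.sum_le_sum fun n _ => ?_
  have h : tau 3 n ^ 4 ≤ tau 81 n :=
    calc tau 3 n ^ 4 = (tau 3 n * tau 3 n) * (tau 3 n * tau 3 n) := by ring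
      _ ≤ tau 9 n * tau 9 n := Nat.mul_le_mul (tau_mul_tau_le 3 3 n) (tau_mul_tau_le 3 3 n)
      _ ≤ tau 81 n := tau_mul_tau_le 9 9 n
  exact_mod_cast h

/-! ### Correlations and the two Cauchy–Schwarz steps -/

open Classical in
/-- The `l ≤ R` for which both `l m` and `l m'` lie in `(N, N + H]`. -/
noncomputable def commonRange (N : ℕ) (H : ℝ) (R m m' : ℕ) : Finset ℕ :=
  (Finset.Ioc 0 R).filter fun l => ((N : ℝ) < l * m ∧ (l : ℝ) * m ≤ N + H) ∧
    ((N : ℝ) < l * m' ∧ (l : ℝ) * m' ≤ N + H)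

/-- The correlation of `l ↦ e (φ (l m))` and `l ↦ e (φ (l m'))`. -/
noncomputable def correlation (N : ℕ) (H : ℝ) (R : ℕ) (φ : ℝ → ℝ) (m m' : ℕ) : ℂ :=
  ∑ l ∈ commonRange N H R m m', e (φ ((l : ℝ) * m) - φ ((l : ℝ) * m'))

theorem card_filter_abs_sub_le (s : Finset ℕ) (m : ℕ) {D : ℝ} (hD : 0 ≤ D) :
    ((s.filter fun m' : ℕ => |(m' : ℝ) - m| ≤ D).card : ℝ) ≤ 2 * D + 1 := by
  have h1 : (s.filter fun m' : ℕ => |(m' : ℝ) - m| ≤ D).card ≤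
      (Finset.Icc (-⌊D⌋) ⌊D⌋).card := by
    refine Finset.card_le_card_of_injOn (fun m' : ℕ => (m' : ℤ) - m) (fun m' hm' => ?_)
      (fun x _ y _ h => by simpa using h)
    have h2 := abs_le.1 (Finset.mem_filter.1 hm').2
    have h3 : (m' : ℤ) - m ≤ ⌊D⌋ := Int.le_floor.2 (by push_cast; exact h2.2)
    have h4 : (m : ℤ) - m' ≤ ⌊D⌋ := Int.le_floor.2 (by push_cast; linarith)
    exact Finset.mem_coe.2 (Finset.mem_Icc.2 ⟨by dsimp only; omega, by dsimp only; omega⟩)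
  have h2 : ((Finset.Icc (-⌊D⌋) ⌊D⌋).card : ℤ) = 2 * ⌊D⌋ + 1 := by
    have := Int.floor_nonneg.2 hD
    rw [Int.card_Icc, Int.toNat_of_nonneg (by omega)]; ring
  have h3 : ((Finset.Icc (-⌊D⌋) ⌊D⌋).card : ℝ) = 2 * ⌊D⌋ + 1 := by exact_mod_cast h2
  have h4 := Int.floor_le D
  have h5 : ((s.filter fun m' : ℕ => |(m' : ℝ) - m| ≤ D).card : ℝ) ≤
    (Finset.Icc (-⌊D⌋) ⌊D⌋).card := by exact_mod_cast h1
  linarith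

/-- Since `m > M`, all relevant `l` lie in an interval of length `H/M`; the endpoint in the count is
absorbed because `H/M ≥ 1`. -/
theorem norm_correlation_le {N R : ℕ} {H : ℝ} (φ : ℝ → ℝ) {M : ℝ} {m m' : ℕ} (hM : 0 < M)
    (hm : M < m) (hH : M ≤ H) : ‖correlation N H R φ m m'‖ ≤ 2 * (H / M) := by
  have hm0 : (0 : ℝ) < m := by linarith
  refine (norm_sum_le _ _).trans ?_
  simp only [norm_e, Finset.sum_const, nsmul_eq_mul, mul_one]
  have hdiff : ∀ l ∈ commonRange N H R m m', ∀ l' ∈ commonRange N H R m m',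
      (l : ℝ) - l' ≤ H / M := by
    intro l hl l' hl'
    have h1 := (Finset.mem_filter.1 hl).2.1.2
    have h2 := (Finset.mem_filter.1 hl').2.1.1
    rw [le_div_iff₀ hM]
    rcases le_total (l : ℝ) l' with h | h
    · have : ((l : ℝ) - l') * M ≤ 0 := mul_nonpos_of_nonpos_of_nonneg (by linarith) hM.le
      linarith
    · have : ((l : ℝ) - l') * M ≤ (l - l') * m := by
        apply mul_le_mul_of_nonneg_left hm.le; linarith
      nlinarith
  rcases (commonRange N H R m m').eq_empty_or_nonempty with h | h
  · have : 0 ≤ H := by linarith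
    rw [h]; simp; positivity
  · set a := (commonRange N H R m m').min' h
    set b := (commonRange N H R m m').max' h
    have h1 : (commonRange N H R m m').card ≤ b + 1 - a := by
      rw [← Nat.card_Icc]
      refine Finset.card_le_card fun x hx => ?_
      exact Finset.mem_Icc.2 ⟨Finset.min'_le _ _ hx, Finset.le_max' _ _ hx⟩
    have hab : a ≤ b := Finset.min'_le _ _ (Finset.max'_mem _ _)
    have h2 : (((commonRange N H R m m').card : ℕ) : ℝ) ≤ b - a + 1 := by
      have : (commonRange N H R m m').card + a ≤ b + 1 := by omega
      have : (((commonRange N H R m m').card : ℕ) : ℝ) + a ≤ b + 1 := by exact_mod_cast this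
      linarith
    have h3 := hdiff b (Finset.max'_mem _ _) a (Finset.min'_mem _ _)
    have h4 : 1 ≤ H / M := by rwa [one_le_div hM]
    linarith

/-- A common `l` would satisfy `l |m' - m| ≤ H` and `l ≥ N/(2M)`. -/
theorem correlation_eq_zero {N R : ℕ} {H : ℝ} (φ : ℝ → ℝ) {M : ℝ} {m m' : ℕ} (hM : 0 < M)
    (hN : (0 : ℝ) < N) (hm : (m : ℝ) ≤ 2 * M)
    (h : ¬ |(m' : ℝ) - m| ≤ 2 * (H * M / N)) : correlation N H R φ m m' = 0 := by
  rw [correlation, Finset.sum_eq_zero]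
  intro l hl
  exfalso
  apply h
  have hl := (Finset.mem_filter.1 hl).2
  have hl0 : (0 : ℝ) ≤ l := by positivity
  have h1 : (l : ℝ) * |(m' : ℝ) - m| ≤ H := by
    have h0 : (l : ℝ) * |(m' : ℝ) - m| = |(l : ℝ) * (m' - m)| := by
      rw [abs_mul, abs_of_nonneg hl0]
    rw [h0, abs_le]
    constructor <;> nlinarith [hl.1.1, hl.1.2, hl.2.1, hl.2.2]
  have h2 : (N : ℝ) ≤ l * (2 * M) := hl.1.1.le.trans (by gcongr)
  have h3 : |(m' : ℝ) - m| * N ≤ 2 * (H * M) := by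
    calc |(m' : ℝ) - m| * N ≤ |(m' : ℝ) - m| * (l * (2 * M)) := by gcongr
      _ = (l * |(m' : ℝ) - m|) * (2 * M) := by ring
      _ ≤ H * (2 * M) := by gcongr
      _ = _ := by ring
  rw [← mul_div_assoc, le_div_iff₀ hN]
  exact h3

/-- The Cauchy–Schwarz inequality for a bilinear sum, the inner square being expanded. -/
theorem norm_bilinear_sq_le (N : ℕ) (H : ℝ) (R : ℕ) (φ : ℝ → ℝ) (s : Finset ℕ) (a b : ℕ → ℂ)
    [DecidablePred fun p : ℕ × ℕ => (N : ℝ) < p.1 * p.2 ∧ (p.1 : ℝ) * p.2 ≤ N + H] :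
    ‖∑ p ∈ (Finset.Ioc 0 R ×ˢ s).filter fun p : ℕ × ℕ =>
        (N : ℝ) < p.1 * p.2 ∧ (p.1 : ℝ) * p.2 ≤ N + H,
      a p.1 * b p.2 * e (φ ((p.1 : ℝ) * p.2))‖ ^ 2 ≤
    (∑ l ∈ Finset.Ioc 0 R, ‖a l‖ ^ 2) *
      ∑ p ∈ s ×ˢ s, ‖b p.1‖ * ‖b p.2‖ * ‖correlation N H R φ p.1 p.2‖ := by
  classical
  set V : ℕ → ℂ := fun l => ∑ m ∈ s, if (N : ℝ) < l * m ∧ (l : ℝ) * m ≤ N + H then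
    b m * e (φ ((l : ℝ) * m)) else 0 with hV
  have h1 : ∑ p ∈ (Finset.Ioc 0 R ×ˢ s).filter fun p : ℕ × ℕ =>
        (N : ℝ) < p.1 * p.2 ∧ (p.1 : ℝ) * p.2 ≤ N + H,
      a p.1 * b p.2 * e (φ ((p.1 : ℝ) * p.2)) = ∑ l ∈ Finset.Ioc 0 R, a l * V l := by
    rw [Finset.sum_filter, Finset.sum_product]
    refine Finset.sum_congr rfl fun l _ => ?_
    rw [hV, Finset.mul_sum]
    refine Finset.sum_congr rfl fun m _ => ?_
    rw [mul_ite, mul_zero]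
    congr 1
    ring
  have h2 : ∑ l ∈ Finset.Ioc 0 R, V l * (starRingEnd ℂ) (V l) =
      ∑ p ∈ s ×ˢ s, b p.1 * (starRingEnd ℂ) (b p.2) * correlation N H R φ p.1 p.2 := by
    rw [Finset.sum_product]
    simp only [hV, map_sum, Finset.sum_mul_sum]
    rw [Finset.sum_comm]
    refine Finset.sum_congr rfl fun m _ => ?_
    rw [Finset.sum_comm]
    refine Finset.sum_congr rfl fun m' _ => ?_
    rw [correlation, commonRange, Finset.sum_filter, Finset.mul_sum]
    refine Finset.sum_congr rfl fun l _ => ?_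
    rw [e_sub]
    by_cases c1 : (N : ℝ) < l * m ∧ (l : ℝ) * m ≤ N + H
    · by_cases c2 : (N : ℝ) < l * m' ∧ (l : ℝ) * m' ≤ N + H
      · rw [if_pos c1, if_pos c2, if_pos ⟨c1, c2⟩, map_mul]; ring
      · have h : ¬ (((N : ℝ) < l * m ∧ (l : ℝ) * m ≤ N + H) ∧
            ((N : ℝ) < l * m' ∧ (l : ℝ) * m' ≤ N + H)) := fun h => c2 h.2
        rw [if_neg c2, if_neg h]; simp
    · have h : ¬ (((N : ℝ) < l * m ∧ (l : ℝ) * m ≤ N + H) ∧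
          ((N : ℝ) < l * m' ∧ (l : ℝ) * m' ≤ N + H)) := fun h => c1 h.1
      rw [if_neg c1, if_neg h]; simp
  have h3 : ∑ l ∈ Finset.Ioc 0 R, ‖V l‖ ^ 2 ≤
      ∑ p ∈ s ×ˢ s, ‖b p.1‖ * ‖b p.2‖ * ‖correlation N H R φ p.1 p.2‖ := by
    have h4 : ((∑ l ∈ Finset.Ioc 0 R, ‖V l‖ ^ 2 : ℝ) : ℂ) =
        ∑ l ∈ Finset.Ioc 0 R, V l * (starRingEnd ℂ) (V l) := by
      push_cast
      exact Finset.sum_congr rfl fun l _ => by rw [Complex.mul_conj, Complex.normSq_eq_norm_sq]; push_cast; rfl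
    have h5 : ∑ l ∈ Finset.Ioc 0 R, ‖V l‖ ^ 2 =
        ‖((∑ l ∈ Finset.Ioc 0 R, ‖V l‖ ^ 2 : ℝ) : ℂ)‖ := by
      rw [Complex.norm_real, Real.norm_of_nonneg]
      exact Finset.sum_nonneg fun _ _ => sq_nonneg _
    rw [h5, h4, h2]
    refine (norm_sum_le _ _).trans (Finset.sum_le_sum fun p _ => ?_)
    rw [norm_mul, norm_mul, RCLike.norm_conj]
  rw [h1]
  calc ‖∑ l ∈ Finset.Ioc 0 R, a l * V l‖ ^ 2 ≤ (∑ l ∈ Finset.Ioc 0 R, ‖a l‖ * ‖V l‖) ^ 2 := by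
        gcongr
        refine (norm_sum_le _ _).trans_eq ?_
        simp_rw [norm_mul]
    _ ≤ (∑ l ∈ Finset.Ioc 0 R, ‖a l‖ ^ 2) * ∑ l ∈ Finset.Ioc 0 R, ‖V l‖ ^ 2 :=
        Finset.sum_mul_sq_le_sq_mul_sq _ _ _
    _ ≤ _ := by
        gcongr

/-- The second application of the Cauchy–Schwarz inequality. -/
theorem sum_mul_correlation_sq_le {N R : ℕ} {H M : ℝ} (φ : ℝ → ℝ) (s : Finset ℕ) (b : ℕ → ℂ)
    (hM : 0 < M) (hN : (0 : ℝ) < N) (hs : ∀ m ∈ s, (m : ℝ) ≤ 2 * M) (hHM : N ≤ H * M) :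
    (∑ p ∈ s ×ˢ s, ‖b p.1‖ * ‖b p.2‖ * ‖correlation N H R φ p.1 p.2‖) ^ 2 ≤
      (∑ m ∈ s, ‖b m‖ ^ 4) * (5 * (H * M / N)) *
        ∑ m ∈ s, ∑ m' ∈ s.filter (fun m' : ℕ => |(m' : ℝ) - m| ≤ 2 * (H * M / N)),
          ‖correlation N H R φ m m'‖ ^ 2 := by
  have hD : 1 ≤ H * M / N := by rwa [one_le_div hN]
  have hH : 0 ≤ H := by
    by_contra h
    have := mul_neg_of_neg_of_pos (not_le.1 h) hM
    linarith
  set D := 2 * (H * M / N) with hDdef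
  set E := (s ×ˢ s).filter fun p : ℕ × ℕ => |(p.2 : ℝ) - p.1| ≤ D with hE
  have h0 : ∑ p ∈ s ×ˢ s, ‖b p.1‖ * ‖b p.2‖ * ‖correlation N H R φ p.1 p.2‖ =
      ∑ p ∈ E, (‖b p.1‖ * ‖b p.2‖) * ‖correlation N H R φ p.1 p.2‖ := by
    rw [hE, Finset.sum_filter]
    refine Finset.sum_congr rfl fun p hp => ?_
    split_ifs with h
    · rfl
    · rw [correlation_eq_zero φ hM hN (hs _ (Finset.mem_product.1 hp).1) h]; simp
  -- The inequality `(xy)² ≤ (x⁴ + y⁴)/2` separates the two variables, and each `m` has at most `2D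
  -- + 1 ≤ 5HM/N` neighbours.
  have h1 : ∑ p ∈ E, (‖b p.1‖ * ‖b p.2‖) ^ 2 ≤ (∑ m ∈ s, ‖b m‖ ^ 4) * (5 * (H * M / N)) := by
    have hcard : ∀ m : ℕ, ((s.filter fun m' : ℕ => |(m' : ℝ) - m| ≤ D).card : ℝ) ≤
        5 * (H * M / N) := fun m => by
      have := card_filter_abs_sub_le s m (D := D) (by positivity)
      linarith
    have hE1 : ∑ p ∈ E, ‖b p.1‖ ^ 4 ≤ (∑ m ∈ s, ‖b m‖ ^ 4) * (5 * (H * M / N)) := by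
      rw [hE, Finset.sum_filter, Finset.sum_product, Finset.sum_mul]
      refine Finset.sum_le_sum fun m _ => ?_
      dsimp only
      rw [← Finset.sum_filter, Finset.sum_const, nsmul_eq_mul, mul_comm]
      gcongr
      exact hcard m
    have hE2 : ∑ p ∈ E, ‖b p.2‖ ^ 4 ≤ (∑ m ∈ s, ‖b m‖ ^ 4) * (5 * (H * M / N)) := by
      rw [hE, Finset.sum_filter, Finset.sum_product_right, Finset.sum_mul]
      refine Finset.sum_le_sum fun m _ => ?_
      dsimp only
      rw [← Finset.sum_filter, Finset.sum_const, nsmul_eq_mul, mul_comm]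
      gcongr
      simp_rw [abs_sub_comm (m : ℝ)]
      exact hcard m
    calc ∑ p ∈ E, (‖b p.1‖ * ‖b p.2‖) ^ 2 ≤ ∑ p ∈ E, (‖b p.1‖ ^ 4 + ‖b p.2‖ ^ 4) / 2 := by
          refine Finset.sum_le_sum fun p _ => ?_
          nlinarith [sq_nonneg (‖b p.1‖ ^ 2 - ‖b p.2‖ ^ 2)]
      _ = (∑ p ∈ E, ‖b p.1‖ ^ 4 + ∑ p ∈ E, ‖b p.2‖ ^ 4) / 2 := by
          rw [← Finset.sum_add_distrib, Finset.sum_div]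
      _ ≤ _ := by linarith
  have h2 : ∑ p ∈ E, ‖correlation N H R φ p.1 p.2‖ ^ 2 =
      ∑ m ∈ s, ∑ m' ∈ s.filter (fun m' : ℕ => |(m' : ℝ) - m| ≤ D),
          ‖correlation N H R φ m m'‖ ^ 2 := by
    rw [hE, Finset.sum_filter, Finset.sum_product]
    simp_rw [← Finset.sum_filter]
  rw [h0, ← h2]
  refine (Finset.sum_mul_sq_le_sq_mul_sq _ _ _).trans ?_
  gcongr

/-- The integers in the dyadic interval `(M, 2M]`. -/
noncomputable def dyadic (M : ℝ) : Finset ℕ :=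
  (Finset.Ioc 0 ⌊2 * M⌋₊).filter fun m : ℕ => M < m

theorem mem_dyadic {M : ℝ} (hM : 0 < M) {m : ℕ} : m ∈ dyadic M ↔ M < m ∧ (m : ℝ) ≤ 2 * M := by
  rw [dyadic, Finset.mem_filter, Finset.mem_Ioc, Nat.le_floor_iff (by positivity)]
  refine ⟨fun h => ⟨h.2, h.1.2⟩, fun h => ⟨⟨?_, h.2⟩, h.1⟩⟩
  have : (0 : ℝ) < m := by linarith
  exact_mod_cast this

/-- The second moment of the correlations of `m` with the elements of `(M, 2M]` close to it. -/
noncomputable def localMoment (N : ℕ) (H M : ℝ) (φ : ℝ → ℝ) (m : ℕ) : ℝ :=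
  ∑ m' ∈ (dyadic M).filter (fun m' : ℕ => |(m' : ℝ) - m| ≤ 2 * (H * M / N)),
    ‖correlation N H ⌊2 * N / M⌋₊ φ m m'‖ ^ 2

theorem localMoment_nonneg (N : ℕ) (H M : ℝ) (φ : ℝ → ℝ) (m : ℕ) :
    0 ≤ localMoment N H M φ m :=
  Finset.sum_nonneg fun _ _ => sq_nonneg _

/-- If a Type II sum is large then the correlations are large on average. -/
theorem sum_localMoment_ge : ∃ A : ℕ, ∀ (X M H : ℝ) (N : ℕ) (φ : ℝ → ℝ) (a b : ℕ → ℂ),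
    2 ≤ X → 2 ≤ M → X * M ≤ H → X * N ≤ H * M → H ≤ N →
    (∀ l : ℕ, 1 ≤ l → ‖a l‖ ≤ tau 5 l) → (∀ m : ℕ, 1 ≤ m → ‖b m‖ ≤ tau 3 m) →
    H * Real.log N ^ 32 ≤ X * ‖∑ p ∈ pairs N H M, a p.1 * b p.2 * e (φ ((p.1 : ℝ) * p.2))‖ →
    H ^ 3 ≤ X ^ A * N * ∑ m ∈ dyadic M, localMoment N H M φ m := by
  -- `266 = 4 + 2(1 + 48) + (1 + 160) + 3`: the fourth power of the hypothesis, the squared moment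
  -- of `a`, the moment of `b`, and the number of neighbours.
  refine ⟨266, fun X M H N φ a b hX hM hMH hNH hHN ha hb hsum => ?_⟩
  classical
  have hX1 : 1 ≤ X := by linarith
  have hX0 : 0 < X := by linarith
  have hle : ∀ {i j : ℕ}, i ≤ j → X ^ i ≤ X ^ j := fun h => pow_le_pow_right₀ hX1 h
  have hM0 : 0 < M := by linarith
  have hH0 : 0 < H := lt_of_lt_of_le (by positivity) hMH
  have hN0 : (0 : ℝ) < N := by linarith
  have hMH' : M ≤ H := le_trans (le_mul_of_one_le_left hM0.le hX1) hMH
  have hNH' : N ≤ H * M := le_trans (le_mul_of_one_le_left hN0.le hX1) hNH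
  have h2MN : 2 * M ≤ N := le_trans (by gcongr) (hMH.trans hHN)
  have hN1 : (2 : ℝ) ≤ N := by linarith
  set ℓ := Real.log N
  have hℓ : 1 / 2 ≤ ℓ := by
    have h1 : Real.log 2 ≤ ℓ := Real.log_le_log (by norm_num) hN1
    have := Real.log_two_gt_d9
    linarith
  have hℓ0 : 0 < ℓ := by linarith
  have h8 : (8 : ℝ) ≤ X ^ 3 := by
    calc (8 : ℝ) = 2 ^ 3 := by norm_num
      _ ≤ X ^ 3 := by gcongr
  have h4 : (4 : ℝ) ≤ X ^ 2 := by nlinarith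
  have hlog : ∀ n : ℕ, n ≤ N → 1 + Real.log n ≤ X ^ 2 * ℓ := by
    intro n hn
    rcases n.eq_zero_or_pos with rfl | hn0
    · simp; nlinarith
    · have : Real.log n ≤ ℓ :=
        Real.log_le_log (by exact_mod_cast hn0) (by exact_mod_cast hn)
      nlinarith
  set R := ⌊2 * N / M⌋₊
  have hRle : (R : ℝ) ≤ 2 * N / M := Nat.floor_le (by positivity)
  have hRN : R ≤ N := by
    have : (R : ℝ) ≤ N := hRle.trans (by rw [div_le_iff₀ hM0]; nlinarith)
    exact_mod_cast this
  have hdyadic : ∀ m ∈ dyadic M, M < m ∧ (m : ℝ) ≤ 2 * M := fun m hm => (mem_dyadic hM0).1 hm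
  have hpairs : pairs N H M = (Finset.Ioc 0 R ×ˢ dyadic M).filter fun p : ℕ × ℕ =>
      (N : ℝ) < p.1 * p.2 ∧ (p.1 : ℝ) * p.2 ≤ N + H := by
    ext p
    rw [mem_pairs, Finset.mem_filter, Finset.mem_product]
    constructor
    · rintro ⟨⟨h1, h2⟩, h3, h5⟩
      have hp2 : (0 : ℝ) < p.2 := by linarith
      have hp1 : (0 : ℝ) < p.1 := by
        by_contra h
        have : (p.1 : ℝ) = 0 := le_antisymm (not_lt.1 h) (by positivity)
        rw [this, zero_mul] at h3; linarith
      refine ⟨⟨Finset.mem_Ioc.2 ⟨by exact_mod_cast hp1, Nat.le_floor ?_⟩,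
        (mem_dyadic hM0).2 ⟨h1, h2⟩⟩,
        h3, h5⟩
      rw [le_div_iff₀ hM0]
      calc (p.1 : ℝ) * M ≤ p.1 * p.2 := by gcongr
        _ ≤ 2 * N := by linarith
    · rintro ⟨⟨_, h2⟩, h3⟩
      exact ⟨hdyadic _ h2, h3⟩
  have hSA : ∑ l ∈ Finset.Ioc 0 R, ‖a l‖ ^ 2 ≤ X * (N / M) * (X ^ 2 * ℓ) ^ 24 := by
    calc ∑ l ∈ Finset.Ioc 0 R, ‖a l‖ ^ 2 ≤ ∑ l ∈ Finset.Ioc 0 R, (tau 5 l : ℝ) ^ 2 := by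
          refine Finset.sum_le_sum fun l hl => ?_
          have := ha l (Finset.mem_Ioc.1 hl).1
          gcongr
      _ ≤ R * (1 + Real.log R) ^ 24 := sum_tau_five_sq_le R
      _ ≤ X * (N / M) * (X ^ 2 * ℓ) ^ 24 := by
          have h0 := Real.log_natCast_nonneg R
          have h1 : (R : ℝ) ≤ X * (N / M) := by
            refine hRle.trans ?_
            rw [mul_div_assoc]; gcongr
          have := hlog R hRN
          gcongr
  have hSB : ∑ m ∈ dyadic M, ‖b m‖ ^ 4 ≤ X * M * (X ^ 2 * ℓ) ^ 80 := by
    have hfl : (⌊2 * M⌋₊ : ℝ) ≤ 2 * M := Nat.floor_le (by positivity)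
    calc ∑ m ∈ dyadic M, ‖b m‖ ^ 4 ≤ ∑ m ∈ Finset.Ioc 0 ⌊2 * M⌋₊, ‖b m‖ ^ 4 :=
          Finset.sum_le_sum_of_subset_of_nonneg (Finset.filter_subset _ _)
            fun _ _ _ => by positivity
      _ ≤ ∑ m ∈ Finset.Ioc 0 ⌊2 * M⌋₊, (tau 3 m : ℝ) ^ 4 := by
          refine Finset.sum_le_sum fun m hm => ?_
          have := hb m (Finset.mem_Ioc.1 hm).1
          gcongr
      _ ≤ ⌊2 * M⌋₊ * (1 + Real.log ⌊2 * M⌋₊) ^ 80 := sum_tau_three_pow_four_le _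
      _ ≤ X * M * (X ^ 2 * ℓ) ^ 80 := by
          have h0 := Real.log_natCast_nonneg ⌊2 * M⌋₊
          have h1 : (⌊2 * M⌋₊ : ℝ) ≤ X * M := hfl.trans (by gcongr)
          have := hlog ⌊2 * M⌋₊ (by
            have : (⌊2 * M⌋₊ : ℝ) ≤ N := hfl.trans h2MN
            exact_mod_cast this)
          gcongr
  set Δ := H * M / N with hΔ
  obtain ⟨K, hK⟩ : ∃ K, K = 266 := ⟨_, rfl⟩
  rw [← hK]
  have h1 := norm_bilinear_sq_le N H R φ (dyadic M) a b
  rw [← hpairs] at h1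
  have h2 := sum_mul_correlation_sq_le (R := R) φ (dyadic M) b hM0 hN0 
    (fun m hm => (hdyadic m hm).2) hNH'
  set S := ‖∑ p ∈ pairs N H M, a p.1 * b p.2 * e (φ ((p.1 : ℝ) * p.2))‖
  set Z := ∑ p ∈ dyadic M ×ˢ dyadic M, ‖b p.1‖ * ‖b p.2‖ * ‖correlation N H R φ p.1 p.2‖ with hZ
  have hW0 : 0 ≤ ∑ m ∈ dyadic M, localMoment N H M φ m :=
    Finset.sum_nonneg fun m _ => localMoment_nonneg N H M φ m
  have h2 : Z ^ 2 ≤ (X * M * (X ^ 2 * ℓ) ^ 80) * (X ^ 3 * Δ) * ∑ m ∈ dyadic M, localMoment N H M φ m := by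
    refine h2.trans ?_
    have : 5 * Δ ≤ X ^ 3 * Δ := by gcongr; linarith
    gcongr
    exact le_rfl
  have hZ0 : 0 ≤ Z := Finset.sum_nonneg fun _ _ => by positivity
  have h3 : S ^ 2 ≤ X * (N / M) * (X ^ 2 * ℓ) ^ 24 * Z := h1.trans (by gcongr)
  -- The logarithms balance exactly: `4·32 = 2·24 + 80`.
  have h5 : (H * ℓ ^ 32) ^ 4 ≤ X ^ K * N * (∑ m ∈ dyadic M, localMoment N H M φ m) * (H * ℓ ^ 128) := by
    calc (H * ℓ ^ 32) ^ 4 ≤ (X * S) ^ 4 := by gcongr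
      _ = X ^ 4 * (S ^ 2) ^ 2 := by ring
      _ ≤ X ^ 4 * (X * (N / M) * (X ^ 2 * ℓ) ^ 24 * Z) ^ 2 := by gcongr
      _ = X ^ 4 * (X * (N / M) * (X ^ 2 * ℓ) ^ 24) ^ 2 * Z ^ 2 := by ring
      _ ≤ X ^ 4 * (X * (N / M) * (X ^ 2 * ℓ) ^ 24) ^ 2 *
          ((X * M * (X ^ 2 * ℓ) ^ 80) * (X ^ 3 * Δ) * ∑ m ∈ dyadic M, localMoment N H M φ m) := by gcongr
      _ = X ^ K * N * (∑ m ∈ dyadic M, localMoment N H M φ m) * (H * ℓ ^ 128) := by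
          rw [hΔ]
          generalize (∑ m ∈ dyadic M, localMoment N H M φ m) = w
          rw [hK]
          field_simp
  have h6 : H ^ 3 * (H * ℓ ^ 128) ≤ X ^ K * N * (∑ m ∈ dyadic M, localMoment N H M φ m) * (H * ℓ ^ 128) := by
    refine le_trans (le_of_eq ?_) h5
    ring
  exact le_of_mul_le_mul_right h6 (by positivity)

/-- If a Type II sum is large then many pairs `(m, m')` have a large correlation. -/
theorem exists_large_correlations : ∃ A : ℕ, ∀ (X M H : ℝ) (N : ℕ) (φ : ℝ → ℝ) (a b : ℕ → ℂ),
    2 ≤ X → 2 ≤ M → X * M ≤ H → X * N ≤ H * M → H ≤ N →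
    (∀ l : ℕ, 1 ≤ l → ‖a l‖ ≤ tau 5 l) → (∀ m : ℕ, 1 ≤ m → ‖b m‖ ≤ tau 3 m) →
    H * Real.log N ^ 32 ≤ X * ‖∑ p ∈ pairs N H M, a p.1 * b p.2 * e (φ ((p.1 : ℝ) * p.2))‖ →
    ∃ (R : ℕ) (s : Finset ℕ), M ≤ X ^ A * s.card ∧
      ∀ m ∈ s, (M < m ∧ (m : ℝ) ≤ 2 * M) ∧ ∃ s' : Finset ℕ, H * M / N ≤ X ^ A * s'.card ∧
        ∀ m' ∈ s', (M < m' ∧ (m' : ℝ) ≤ 2 * M) ∧ |(m' : ℝ) - m| ≤ 2 * (H * M / N) ∧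
          H / M ≤ X ^ A * ‖correlation N H R φ m m'‖ := by
  obtain ⟨K, hK⟩ := sum_localMoment_ge
  refine ⟨3 * K + 30, fun X M H N φ a b hX hM hMH hNH hHN ha hb hsum => ?_⟩
  have hmain := hK X M H N φ a b hX hM hMH hNH hHN ha hb hsum
  classical
  have hX1 : 1 ≤ X := by linarith
  have hX0 : 0 < X := by linarith
  have hle : ∀ {i j : ℕ}, i ≤ j → X ^ i ≤ X ^ j := fun h => pow_le_pow_right₀ hX1 h
  have hM0 : 0 < M := by linarith
  have hH0 : 0 < H := lt_of_lt_of_le (by positivity) hMH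
  have hN0 : (0 : ℝ) < N := by linarith
  have hMH' : M ≤ H := le_trans (le_mul_of_one_le_left hM0.le hX1) hMH
  have hNH' : N ≤ H * M := le_trans (le_mul_of_one_le_left hN0.le hX1) hNH
  have h2MN : 2 * M ≤ N := le_trans (by gcongr) (hMH.trans hHN)
  have hN1 : (2 : ℝ) ≤ N := by linarith
  have h8 : (8 : ℝ) ≤ X ^ 3 := by
    calc (8 : ℝ) = 2 ^ 3 := by norm_num
      _ ≤ X ^ 3 := by gcongr
  set R := ⌊2 * N / M⌋₊
  have hRle : (R : ℝ) ≤ 2 * N / M := Nat.floor_le (by positivity)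
  have hRN : R ≤ N := by
    have : (R : ℝ) ≤ N := hRle.trans (by rw [div_le_iff₀ hM0]; nlinarith)
    exact_mod_cast this
  have hdyadic : ∀ m ∈ dyadic M, M < m ∧ (m : ℝ) ≤ 2 * M := fun m hm => (mem_dyadic hM0).1 hm
  set Δ := H * M / N with hΔ
  have hΔ1 : 1 ≤ Δ := by rwa [hΔ, one_le_div hN0]
  set U := fun m m' => ‖correlation N H R φ m m'‖ with hU
  set nb : ℕ → Finset ℕ := fun m => (dyadic M).filter (fun m' : ℕ => |(m' : ℝ) - m| ≤ 2 * Δ) with hnb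
  obtain ⟨W, hW⟩ : ∃ W : ℕ → ℝ, W = localMoment N H M φ := ⟨_, rfl⟩
  have hWsum : ∀ m, W m = ∑ m' ∈ nb m, U m m' ^ 2 := fun m => by rw [hW]; rfl
  have hW0 : ∀ m, 0 ≤ W m := fun m => hW ▸ localMoment_nonneg N H M φ m
  rw [← hW] at hmain
  have hnbcard : ∀ m, ((nb m).card : ℝ) ≤ X ^ 3 * Δ := fun m => by
    have h1 := card_filter_abs_sub_le (dyadic M) m (D := 2 * Δ) (by positivity)
    calc ((nb m).card : ℝ) ≤ 8 * Δ := by linarith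
      _ ≤ X ^ 3 * Δ := by gcongr
  have hUle : ∀ m ∈ dyadic M, ∀ m', U m m' ^ 2 ≤ X ^ 2 * (H / M) ^ 2 := by
    intro m hm m'
    rw [← mul_pow]
    have h1 : U m m' ≤ 2 * (H / M) := norm_correlation_le φ hM0 (hdyadic m hm).1 hMH'
    have h2 : 0 ≤ U m m' := norm_nonneg _
    have h3 : U m m' ≤ X * (H / M) := h1.trans (by gcongr)
    gcongr
  -- `B` is the trivial bound for `W m`: at most `X³Δ` neighbours, each contributing at most
  -- `X²(H/M)²`. As `MΔ(H/M)² = H³/N`, the total moment is within a power of `X` of its maximum.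
  -- Popularity is then applied twice, to `m` and to its neighbours `m'`.
  set B := X ^ 5 * (Δ * (H / M) ^ 2) with hB
  have hBpos : 0 < B := by positivity
  have hWle : ∀ m ∈ dyadic M, W m ≤ (nb m).card * (X ^ 2 * (H / M) ^ 2) := by
    intro m hm
    rw [hWsum, ← nsmul_eq_mul]
    exact Finset.sum_le_card_nsmul _ _ _ fun m' _ => hUle m hm m'
  have hWB : ∀ m ∈ dyadic M, W m ≤ B := by
    intro m hm
    refine (hWle m hm).trans ?_
    calc _ ≤ X ^ 3 * Δ * (X ^ 2 * (H / M) ^ 2) := by gcongr; exact hnbcard m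
      _ = B := by rw [hB]; ring
  have hdcard : ((dyadic M).card : ℝ) ≤ 2 * M := by
    refine le_trans ?_ (Nat.floor_le (show 0 ≤ 2 * M by positivity))
    exact_mod_cast (Finset.card_filter_le _ _).trans_eq (by simp)
  have hpop := card_le_mul_card_popular (dyadic M) W (B := B) (Y := X ^ (K + 6)) hBpos (by positivity) hWB
    (by
      calc ((dyadic M).card : ℝ) * B ≤ X * M * B := by
            gcongr; exact hdcard.trans (by gcongr)
        _ = X ^ 6 * H ^ 3 / N := by rw [hB, hΔ]; field_simp
        _ ≤ X ^ 6 * (X ^ K * N * ∑ m ∈ dyadic M, W m) / N := by gcongr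
        _ = _ := by field_simp; ring)
  obtain ⟨s, hs⟩ : ∃ s, s = (dyadic M).filter fun m => B ≤ 2 * X ^ (K + 6) * W m := ⟨_, rfl⟩
  rw [← hs] at hpop
  refine ⟨R, s, ?_, fun m hm => ?_⟩
  · have h1 : M ≤ 2 * (dyadic M).card := by
      have h2 : Finset.Ioc ⌊M⌋₊ ⌊2 * M⌋₊ ⊆ dyadic M := by
        intro m hm
        rw [Finset.mem_Ioc] at hm
        rw [dyadic, Finset.mem_filter, Finset.mem_Ioc]
        exact ⟨⟨by omega, hm.2⟩, (Nat.floor_lt hM0.le).1 hm.1⟩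
      have h3 := Finset.card_le_card h2
      rw [Nat.card_Ioc] at h3
      have h5 := Nat.lt_floor_add_one (2 * M)
      have h6 := Nat.floor_le hM0.le
      have h7 : (⌊2 * M⌋₊ : ℝ) ≤ (dyadic M).card + ⌊M⌋₊ := by exact_mod_cast (by omega)
      linarith
    calc M ≤ 2 * (2 * X ^ (K + 6) * s.card) := h1.trans (by gcongr)
      _ ≤ X * (X * X ^ (K + 6) * s.card) := by gcongr
      _ = X ^ (K + 8) * s.card := by ring
      _ ≤ _ := by
        have := hle (show K + 8 ≤ 3 * K + 30 by omega)
        gcongr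
  · rw [hs, Finset.mem_filter] at hm
    obtain ⟨hm, hBW⟩ := hm
    refine ⟨hdyadic m hm, ?_⟩
    have hBW' : B ≤ X ^ (K + 7) * W m := by
      have hW0 := hW0 m
      calc B ≤ 2 * X ^ (K + 6) * W m := hBW
        _ ≤ X * X ^ (K + 6) * W m := by gcongr
        _ = _ := by ring
    have hpop' := card_le_mul_card_popular (nb m) (fun m' => U m m' ^ 2)
      (B := X ^ 2 * (H / M) ^ 2) (Y := X ^ (K + 7)) (by positivity) (by positivity)
      (fun m' _ => hUle m hm m') (by
        rw [← hWsum]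
        refine le_trans ?_ hBW'
        calc _ ≤ X ^ 3 * Δ * (X ^ 2 * (H / M) ^ 2) := by gcongr; exact hnbcard m
          _ = B := by rw [hB]; ring)
    obtain ⟨s', hs'⟩ : ∃ s', s' = (nb m).filter fun m' =>
      X ^ 2 * (H / M) ^ 2 ≤ 2 * X ^ (K + 7) * U m m' ^ 2 := ⟨_, rfl⟩
    rw [← hs'] at hpop'
    have hnbge : Δ ≤ X ^ (K + 4) * (nb m).card := by
      have h1 : Δ * (X ^ 5 * (H / M) ^ 2) ≤ X ^ (K + 4) * (nb m).card * (X ^ 5 * (H / M) ^ 2) := by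
        calc Δ * (X ^ 5 * (H / M) ^ 2) = B := by rw [hB]; ring
          _ ≤ X ^ (K + 7) * ((nb m).card * (X ^ 2 * (H / M) ^ 2)) :=
            hBW'.trans (by gcongr; exact hWle m hm)
          _ = _ := by ring
      exact le_of_mul_le_mul_right h1 (by positivity)
    refine ⟨s', ?_, fun m' hm' => ?_⟩
    · calc Δ ≤ X ^ (K + 4) * (2 * X ^ (K + 7) * s'.card) := hnbge.trans (by gcongr)
        _ ≤ X ^ (K + 4) * (X * X ^ (K + 7) * s'.card) := by gcongr
        _ = X ^ (2 * K + 12) * s'.card := by ring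
        _ ≤ _ := by
          have := hle (show 2 * K + 12 ≤ 3 * K + 30 by omega)
          gcongr
    · rw [hs', Finset.mem_filter] at hm'
      obtain ⟨h1, h2⟩ := hm'
      obtain ⟨h1, h3⟩ := Finset.mem_filter.1 h1
      refine ⟨hdyadic m' h1, h3, ?_⟩
      have hU0 : 0 ≤ U m m' := norm_nonneg _
      have h5 : X * (H / M) ^ 2 ≤ X * ((X ^ (K + 7) * U m m') ^ 2) := by
        have h6 : X ^ 2 * (H / M) ^ 2 ≤ X * X ^ (K + 7) * U m m' ^ 2 := h2.trans (by gcongr)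
        have h7 : X ^ (K + 7) ≤ X ^ (K + 7) * X ^ (K + 7) :=
          le_mul_of_one_le_left (by positivity) (one_le_pow₀ hX1)
        calc X * (H / M) ^ 2 ≤ X * (X * (H / M) ^ 2) := by
              gcongr; exact le_mul_of_one_le_left (by positivity) hX1
          _ = X ^ 2 * (H / M) ^ 2 := by ring
          _ ≤ X * X ^ (K + 7) * U m m' ^ 2 := h6
          _ ≤ X * (X ^ (K + 7) * X ^ (K + 7)) * U m m' ^ 2 := by gcongr
          _ = _ := by ring
      have h8 : H / M ≤ X ^ (K + 7) * U m m' :=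
        (sq_le_sq₀ (by positivity) (by positivity)).1 (le_of_mul_le_mul_left h5 hX0)
      refine h8.trans ?_
      have := hle (show K + 7 ≤ 3 * K + 30 by omega)
      gcongr

/-! ### The polynomial `x g'(x)` -/

/-- The polynomial `∑ α_j X ^ j`, so that `g(x)` is its value at `x - N`. -/
noncomputable def gPoly (k : ℕ) (α : ℕ → ℝ) : ℝ[X] :=
  ∑ j ∈ Finset.Icc 1 k, C (α j) * X ^ j

theorem g_eq_eval (k N : ℕ) (α : ℕ → ℝ) (x : ℝ) : g k N α x = (gPoly k α).eval (x - N) := by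
  simp [g, gPoly, eval_finsetSum]

theorem coeff_gPoly (k : ℕ) (α : ℕ → ℝ) (i : ℕ) :
    (gPoly k α).coeff i = if i ∈ Finset.Icc 1 k then α i else 0 := by
  simp only [gPoly, finsetSum_coeff, coeff_C_mul, coeff_X_pow, mul_ite, mul_one, mul_zero]
  rw [Finset.sum_ite_eq]

theorem natDegree_gPoly_le (k : ℕ) (α : ℕ → ℝ) : (gPoly k α).natDegree ≤ k := by
  rw [natDegree_le_iff_coeff_eq_zero]
  intro m hm
  rw [coeff_gPoly, if_neg (by rw [Finset.mem_Icc]; omega)]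

theorem coeff_comp_linear (p : ℝ[X]) (u v : ℝ) (j : ℕ) :
    (p.comp (C u + C v * X)).coeff j = v ^ j * (hasseDeriv j p).eval u := by
  have h : p.comp (C u + C v * X) = (taylor u p).comp (C v * X) := by
    rw [taylor_apply, comp_assoc]; congr 1
    simp [add_comm]
  rw [h, comp_C_mul_X_coeff, taylor_coeff, mul_comm]

theorem natDegree_comp_linear_le (p : ℝ[X]) (u v : ℝ) :
    (p.comp (C u + C v * X)).natDegree ≤ p.natDegree := by
  refine natDegree_comp_le.trans ?_
  have : (C u + C v * X : ℝ[X]).natDegree ≤ 1 := by compute_degree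
  nlinarith

/-- The polynomial `x g'(x)`, expanded around `N`. -/
noncomputable def eulerPoly (N : ℝ) (p : ℝ[X]) : ℝ[X] := (X + C N) * derivative p

theorem natDegree_eulerPoly_le {N : ℝ} {p : ℝ[X]} {k : ℕ} (hp : p.natDegree ≤ k) (hk : 1 ≤ k) :
    (eulerPoly N p).natDegree ≤ k := by
  refine natDegree_mul_le.trans ?_
  have h1 : (X + C N : ℝ[X]).natDegree ≤ 1 := by compute_degree
  have h2 := natDegree_derivative_le p
  omega

/-- Identifies the combinations of `α_j` and `α_{j+1}` in the conclusion as coefficients of a single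
polynomial. -/
theorem coeff_eulerPoly (N : ℝ) (p : ℝ[X]) {j : ℕ} (hj : 1 ≤ j) :
    (eulerPoly N p).coeff j = j * p.coeff j + (j + 1) * N * p.coeff (j + 1) := by
  obtain ⟨i, rfl⟩ : ∃ i, j = i + 1 := ⟨j - 1, by omega⟩
  rw [eulerPoly, add_mul, coeff_add, coeff_X_mul, coeff_C_mul, coeff_derivative, coeff_derivative]
  push_cast; ring

/-- The operator `x d/dx` does not depend on the centre of expansion; translation by `u` only moves
that centre from `N` to `N + u`. -/
theorem taylor_eulerPoly (N u : ℝ) (p : ℝ[X]) :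
    taylor u (eulerPoly N p) = eulerPoly (u + N) (taylor u p) := by
  rw [eulerPoly, eulerPoly, taylor_mul]
  congr 1
  · simp [taylor_apply, add_assoc]
  · simp [taylor_apply, derivative_comp]

/-- The coefficient of `s` in `(m + s) ^ j p⁽ʲ⁾(l (m + s) - N) / j!`. -/
theorem coeff_one_bilinear (p : ℝ[X]) (m l N : ℝ) {j : ℕ} (hj : 1 ≤ j) :
    ((C m + X) ^ j * (hasseDeriv j p).comp (C (l * m - N) + C l * X)).coeff 1 =
      m ^ (j - 1) * (taylor (l * m - N) (eulerPoly N p)).coeff j := by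
  have h1 : ∀ q : ℝ[X], q.coeff 1 = (derivative q).eval 0 := by
    intro q
    rw [← coeff_zero_eq_eval_zero, coeff_derivative]; simp
  have h2 : ((hasseDeriv j p).comp (C (l * m - N) + C l * X)).coeff 1 =
      l * ((j + 1) * (taylor (l * m - N) p).coeff (j + 1)) := by
    rw [coeff_comp_linear, pow_one, taylor_coeff]
    have := congrArg (fun f => f p) (hasseDeriv_comp (R := ℝ) 1 j)
    simp only [LinearMap.comp_apply, LinearMap.smul_apply, Nat.choose_one_right] at this
    rw [this, add_comm 1 j]
    simp
  -- At `u = lm - N` the centre is `lm`. With `c_i` the Taylor coefficients of `p` at `u`, both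
  -- sides equal `m^(j-1) (j c_j + (j+1) l m c_{j+1})`, the left one by the product rule.
  rw [taylor_eulerPoly, coeff_eulerPoly _ _ hj, mul_coeff_one, h2]
  have h3 : ((C m + X : ℝ[X]) ^ j).coeff 0 = m ^ j := by
    rw [coeff_zero_eq_eval_zero]; simp
  have h4 : ((C m + X : ℝ[X]) ^ j).coeff 1 = j * m ^ (j - 1) := by
    rw [h1, derivative_pow]; simp
  have h5 : ((hasseDeriv j p).comp (C (l * m - N) + C l * X)).coeff 0 =
      (taylor (l * m - N) p).coeff j := by
    rw [coeff_zero_eq_eval_zero, taylor_coeff, eval_comp]; simp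
  have h6 : m ^ j = m ^ (j - 1) * m := by rw [← pow_succ]; congr 1; omega
  rw [h3, h4, h5, h6]; ring

/-! ### From correlations to coefficients -/

/-- If `m` has a large correlation with many `m'` then the Taylor coefficients of the polynomial
`x g'(x)` near `N` are, up to a power of `m`, close to rationals. -/
theorem taylor_eulerPoly_of_large_correlations (k e : ℕ) : ∃ A : ℕ, ∀ (X H M : ℝ) (N R : ℕ)
    (α : ℕ → ℝ) (m : ℕ) (s : Finset ℕ), 2 ≤ X → 0 < M → X ^ A * M ≤ H → X ^ A * N ≤ H * M →
    (0 : ℝ) < N → M < m → (m : ℝ) ≤ 2 * M → H * M / N ≤ X ^ e * s.card →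
    (∀ m' ∈ s, |(m' : ℝ) - m| ≤ 2 * (H * M / N) ∧
      H / M ≤ X ^ e * ‖correlation N H R (g k N α) m m'‖) →
    ∃ u : ℤ, |(u : ℝ)| ≤ H ∧ ∀ j, 1 ≤ j → j ≤ k → ∃ q : ℕ, 1 ≤ q ∧ (q : ℝ) ≤ X ^ A ∧
      distInt (q * ((m : ℝ) ^ (j - 1) * (taylor (u : ℝ) (eulerPoly N (gPoly k α))).coeff j)) ≤
        X ^ A * ((M / H) ^ j * (N / (H * M))) := by
  obtain ⟨A₁, hA₁⟩ := weyl_inequality k (e + 1)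
  -- The degree is `2k` because `F j` has a factor `(m + s)^j` and a factor of degree at most `k`.
  obtain ⟨A₂, hA₂⟩ := vinogradov_polynomial (2 * k) (e + A₁ + 1)
  refine ⟨A₁ + A₂ + 1, fun X H M N R α m s hX hM hMH hNH hN hm hm2 hs hcorr => ?_⟩
  have hX1 : 1 ≤ X := by linarith
  have hX0 : 0 < X := by linarith
  have hle : ∀ {i j : ℕ}, i ≤ j → X ^ i ≤ X ^ j := fun h => pow_le_pow_right₀ hX1 h
  have hH : 0 < H := lt_of_lt_of_le (by positivity) hMH
  have hm0 : (0 : ℝ) < m := by linarith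
  have hmN : 0 < m := by exact_mod_cast hm0
  have hMH2 : 2 * M ≤ H := by
    refine le_trans ?_ hMH
    gcongr
    exact hX.trans (le_self_pow₀ hX1 (by omega))
  set T := H / M with hT
  have hTA : X ^ (A₁ + A₂) ≤ T := by
    rw [hT, le_div_iff₀ hM]
    refine le_trans ?_ hMH
    have := hle (show A₁ + A₂ ≤ A₁ + A₂ + 1 by omega)
    gcongr
  have hT1 : 1 ≤ T := (one_le_pow₀ hX1).trans hTA
  have hT0 : 0 < T := by linarith
  set S := H * M / N with hS
  have hSA : X ^ A₂ ≤ S := by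
    rw [hS, le_div_iff₀ hN]
    refine le_trans ?_ hNH
    have := hle (show A₂ ≤ A₁ + A₂ + 1 by omega)
    gcongr
  have hS0 : 0 < S := lt_of_lt_of_le (by positivity) hSA
  -- With this centre `l₀m - N` lies in `(-m, 0]`, and `t = l - l₀` runs over positive integers at
  -- most `2H/M`. Since `l₀` does not depend on `m'`, the coefficients of the phase are polynomials
  -- in `m' - m`.
  set l₀ : ℕ := N / m with hl₀
  have hl₀le : (l₀ : ℝ) * m ≤ N := by exact_mod_cast Nat.div_mul_le_self N m
  have hl₀gt : (N : ℝ) < l₀ * m + m := by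
    have := Nat.lt_div_mul_add (a := N) hmN
    exact_mod_cast this
  set p := gPoly k α with hp
  set P : ℕ → ℝ[X] := fun m' => p.comp (C ((l₀ : ℝ) * m - N) + C (m : ℝ) * Polynomial.X) -
    p.comp (C ((l₀ : ℝ) * m' - N) + C (m' : ℝ) * Polynomial.X) with hP
  set F : ℕ → ℝ[X] := fun j => (C (m : ℝ) + Polynomial.X) ^ j *
    (hasseDeriv j p).comp (C ((l₀ : ℝ) * m - N) + C (l₀ : ℝ) * Polynomial.X) with hF
  have hPF : ∀ m' j : ℕ, (P m').coeff j =
      (F j).eval 0 - (F j).eval (((m' : ℤ) - m : ℤ) : ℝ) := by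
    intro m' j
    simp only [hP, hF, coeff_sub, coeff_comp_linear, eval_mul, eval_pow, eval_add, eval_C, eval_X,
      eval_comp]
    push_cast
    congr 2
    · ring
    · congr 1; ring
    · ring
    · congr 1; ring
  have hweyl : ∀ m' ∈ s, ∃ q : ℕ, 1 ≤ q ∧ (q : ℝ) ≤ X ^ A₁ ∧
      ∀ j, 1 ≤ j → distInt (q * (P m').coeff j) ≤ X ^ A₁ / T ^ j := by
    intro m' hm'
    set I : Finset ℤ := (commonRange N H R m m').image fun l : ℕ => (l : ℤ) - l₀ with hI
    refine hA₁ X T (P m') I hX hT1 ?_ ?_ ?_ ?_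
    · refine (natDegree_sub_le _ _).trans (max_le ?_ ?_) <;>
        exact (natDegree_comp_linear_le _ _ _).trans (natDegree_gPoly_le k α)
    · refine ⟨fun x hx y hy z hz => ?_⟩
      simp only [hI, Finset.coe_image, Set.mem_image, Finset.mem_coe] at hx hy ⊢
      obtain ⟨l₁, h1, rfl⟩ := hx
      obtain ⟨l₂, h2, rfl⟩ := hy
      obtain ⟨h1R, h1⟩ := Finset.mem_filter.1 h1
      obtain ⟨h2R, h2⟩ := Finset.mem_filter.1 h2
      rw [Finset.mem_Ioc] at h1R h2R
      obtain ⟨hz1, hz2⟩ := hz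
      have hlz1 : l₁ ≤ (z + l₀).toNat := by omega
      have hlz2 : (z + l₀).toNat ≤ l₂ := by omega
      have hlz1' : (l₁ : ℝ) ≤ (z + l₀).toNat := by exact_mod_cast hlz1
      have hlz2' : ((z + l₀).toNat : ℝ) ≤ l₂ := by exact_mod_cast hlz2
      refine ⟨(z + l₀).toNat, Finset.mem_filter.2 ⟨Finset.mem_Ioc.2 ⟨by omega, by omega⟩,
        ⟨lt_of_lt_of_le h1.1.1 ?_, le_trans ?_ h2.1.2⟩,
        ⟨lt_of_lt_of_le h1.2.1 ?_, le_trans ?_ h2.2.2⟩⟩, by omega⟩ <;> gcongr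
    · intro t ht
      obtain ⟨l, hl, rfl⟩ := Finset.mem_image.1 ht
      have hl := (Finset.mem_filter.1 hl).2.1
      push_cast
      have h1 : 0 < (l : ℝ) - l₀ := by
        by_contra h
        have h' : (l : ℝ) ≤ l₀ := by linarith
        have := mul_le_mul_of_nonneg_right h' hm0.le
        linarith [hl.1]
      have h2 : ((l : ℝ) - l₀) * M ≤ 2 * H := by
        have h3 : ((l : ℝ) - l₀) * M ≤ (l - l₀) * m := by gcongr
        rw [sub_mul _ _ (m : ℝ)] at h3
        linarith [hl.2]
      have h4 : (l : ℝ) - l₀ ≤ 2 * T := by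
        rw [hT, ← mul_div_assoc, le_div_iff₀ hM]; exact h2
      rw [abs_of_pos h1]
      refine h4.trans ?_
      have := hX.trans (le_self_pow₀ hX1 (show e + 1 ≠ 0 by omega))
      gcongr
    · have h1 : ∑ t ∈ I, ShortIntervalTypeII.e ((P m').eval (t : ℝ)) =
          correlation N H R (g k N α) m m' := by
        rw [hI, Finset.sum_image (fun x _ y _ h => by simpa using h), correlation]
        refine Finset.sum_congr rfl fun l _ => ?_
        rw [g_eq_eval, g_eq_eval]
        simp only [hP, eval_sub, eval_comp, eval_add, eval_mul, eval_C, eval_X]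
        push_cast
        congr 3 <;> ring
      rw [h1]
      refine (hcorr m' hm').2.trans ?_
      have := hle (show e ≤ e + 1 by omega)
      gcongr
  obtain ⟨q, hq1, hqA, s', hs's, hs'card, hs'⟩ :=
    exists_common_nat s (one_le_pow₀ hX1) _ hweyl
  refine ⟨(l₀ : ℤ) * m - N, ?_, fun j hj hjk => ?_⟩
  · push_cast
    rw [abs_le]; constructor <;> linarith
  have hTj : T ≤ T ^ j := le_self_pow₀ hT1 (by omega)
  -- For fixed `j` the roles change: the coefficients found by Weyl's inequality are values of one
  -- polynomial in `m' - m`, close to integers for many `m'` after multiplication by the common `q`.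
  -- Only the linear coefficient is kept from Vinogradov's lemma.
  obtain ⟨r, hr1, hrA, hr⟩ := hA₂ X S (X ^ A₁ / T ^ j) (C (q : ℝ) * (C ((F j).eval 0) - F j))
    (s'.image fun m' : ℕ => (m' : ℤ) - m) hX hSA (by
      rw [div_mul_eq_mul_div, ← pow_add, div_le_one (by positivity)]
      exact hTA.trans hTj)
    (by
      refine natDegree_C_mul_le _ _ |>.trans ((natDegree_sub_le _ _).trans (max_le (by simp) ?_))
      refine natDegree_mul_le.trans ?_
      have h1 : ((C (m : ℝ) + Polynomial.X) ^ j).natDegree ≤ j := by compute_degree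
      have h2 := (natDegree_comp_linear_le (hasseDeriv j p) ((l₀ : ℝ) * m - N) l₀).trans
        ((natDegree_hasseDeriv_le p j).trans (Nat.sub_le _ _))
      have h3 := natDegree_gPoly_le k α
      rw [← hp] at h3
      omega)
    (by
      intro h hh
      obtain ⟨m', hm', rfl⟩ := Finset.mem_image.1 hh
      push_cast
      refine (hcorr m' (hs's hm')).1.trans ?_
      have := hX.trans (le_self_pow₀ hX1 (show e + A₁ + 1 ≠ 0 by omega))
      gcongr)
    (by
      rw [Finset.card_image_of_injective _ fun x y h => by simpa using h]
      calc S ≤ X ^ e * (X ^ A₁ * s'.card) := hs.trans (by gcongr)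
        _ = X ^ (e + A₁) * s'.card := by ring
        _ ≤ _ := by
          have := hle (show e + A₁ ≤ e + A₁ + 1 by omega)
          gcongr)
    (by
      intro h hh
      obtain ⟨m', hm', rfl⟩ := Finset.mem_image.1 hh
      rw [eval_mul, eval_C, eval_sub, eval_C, ← hPF]
      exact hs' m' hm' j hj)
  have hr := hr 1 le_rfl
  rw [coeff_C_mul, coeff_sub, coeff_C_of_ne_zero (by norm_num), zero_sub, hF,
    coeff_one_bilinear _ _ _ _ hj] at hr
  refine ⟨r * q, Nat.mul_pos hr1 hq1, ?_, ?_⟩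
  · push_cast
    calc (r : ℝ) * q ≤ X ^ A₂ * X ^ A₁ := by gcongr
      _ = X ^ (A₁ + A₂) := by ring
      _ ≤ _ := hle (by omega)
  · have hneg : ∀ x : ℝ, distInt (-x) = distInt x := fun x => by
      rw [distInt_eq_norm, distInt_eq_norm, AddCircle.coe_neg, norm_neg]
    rw [mul_neg, mul_neg, hneg] at hr
    push_cast
    rw [mul_assoc]
    refine hr.trans ?_
    rw [pow_one]
    calc X ^ A₂ * (X ^ A₁ / T ^ j) / S = X ^ (A₁ + A₂) * ((M / H) ^ j * (N / (H * M))) := by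
          rw [hT, hS, pow_add, div_pow, div_pow]; field_simp
      _ ≤ _ := by
          have := hle (show A₁ + A₂ ≤ A₁ + A₂ + 1 by omega)
          gcongr

/-- Recovering rational approximations to the coefficients of `D` from those to
`m ^ (j - 1) D⁽ʲ⁾(u_m) / j!` for many `m`. -/
theorem coeff_of_taylor_coeff_mul_pow (k e n : ℕ) : ∃ A : ℕ, ∀ (X H M N : ℝ) (D : ℝ[X])
    (s : Finset ℕ) (u : ℕ → ℤ), 2 ≤ X → 0 < M → 0 < N → X ^ A * M ≤ H → X ^ A * N ≤ H * M →
    H ≤ N → D.natDegree ≤ k → M ≤ X ^ e * s.card → (∀ m ∈ s, (m : ℝ) ≤ 2 * M) →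
    (∀ m ∈ s, |(u m : ℝ)| ≤ H) →
    (∀ m ∈ s, ∀ j, 1 ≤ j → j ≤ k → ∃ q : ℕ, 1 ≤ q ∧ (q : ℝ) ≤ X ^ e ∧
      distInt (q * ((m : ℝ) ^ (j - 1) * (taylor (u m : ℝ) D).coeff j)) ≤
        X ^ e * ((M / H) ^ j * (N / (H * M)))) →
    ∃ q : ℕ, 1 ≤ q ∧ (q : ℝ) ≤ X ^ A ∧ ∀ j, 1 ≤ j → j ≤ k → k < j + n →
      distInt (q * D.coeff j) ≤ X ^ A * (N / H ^ (j + 1)) := by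
  -- Downward induction again: `n` counts the top coefficients of `D` already treated.
  induction n with
  | zero =>
    exact ⟨0, fun X H M N D s u hX _ _ _ _ _ _ _ _ _ _ =>
      ⟨1, le_rfl, by simp, fun j _ h1 h2 => by omega⟩⟩
  | succ n ih =>
    obtain ⟨A, ih⟩ := ih
    obtain ⟨A₁, hA₁⟩ := vinogradov_polynomial k (2 * e + 1)
    set K := A + e + 3 * k + 1 with hK
    refine ⟨A + A₁ + K, fun X H M N D s u hX hM hN hMH hNH hHN hD hs hs2 hu h => ?_⟩
    have hX1 : 1 ≤ X := by linarith
    have hX0 : 0 < X := by linarith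
    have hle : ∀ {i j : ℕ}, i ≤ j → X ^ i ≤ X ^ j := fun h => pow_le_pow_right₀ hX1 h
    have hlem : ∀ {i : ℕ} {x y : ℝ}, 0 ≤ x → i ≤ A + A₁ + K → X ^ (A + A₁ + K) * x ≤ y →
        X ^ i * x ≤ y := fun hx hi hy => le_trans (by have := hle hi; gcongr) hy
    have hH : 0 < H := lt_of_lt_of_le (by positivity) hMH
    obtain ⟨r, hr1, hrA, hr⟩ := ih X H M N D s u hX hM hN (hlem hM.le (by omega) hMH)
      (hlem hN.le (by omega) hNH) hHN hD hs hs2 hu h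
    have hmono : ∀ {i : ℕ} {x : ℝ}, 0 ≤ x → i ≤ A + A₁ + K → X ^ i * x ≤ X ^ (A + A₁ + K) * x :=
      fun hx hi => by have := hle hi; gcongr
    by_cases hn : 1 + n ≤ k
    swap
    · exact ⟨r, hr1, hrA.trans (hle (by omega)), fun j h1 h2 h3 =>
        (hr j h1 h2 (by omega)).trans (hmono (by positivity) (by omega))⟩
    obtain ⟨j, hjk⟩ : ∃ j, k = j + n := ⟨k - n, by omega⟩
    have hj1 : 1 ≤ j := by omega
    obtain ⟨q, hq1, hqA, s', hs's, hs'card, hs'⟩ := exists_common_nat s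
      (one_le_pow₀ hX1 : 1 ≤ X ^ e) _ fun m hm => h m hm j hj1 (by omega)
    have hMpos : M ≤ X ^ (2 * e) * s'.card := by
      calc M ≤ X ^ e * (X ^ e * s'.card) := hs.trans (by gcongr)
        _ = _ := by ring
    set ε := X ^ K * (M ^ (j - 1) * (N / H ^ (j + 1))) with hε
    -- Exhibits the factor `M^(j-1)`, which Vinogradov's lemma for the monomial `m^(j-1)` removes.
    have hMj : (M / H) ^ j * (N / (H * M)) = M ^ (j - 1) * (N / H ^ (j + 1)) := by
      have : M ^ j = M ^ (j - 1) * M := by rw [← pow_succ]; congr 1; omega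
      rw [div_pow, this, pow_succ]; field_simp
    -- Since `|u m| ≤ H`, a coefficient of degree `i > j` enters with weight about `H^(i-j)`, which
    -- turns its error `N/H^(i+1)` into `N/H^(j+1)`.
    have hmain : ∀ m ∈ s', distInt ((r * q * D.coeff j) * (m : ℝ) ^ (j - 1)) ≤ ε := by
      intro m hm
      have h1 := hs' m hm
      rw [hMj] at h1
      have hc := taylor_sub_coeff hD (u m : ℝ) j
      rw [coeff_sub] at hc
      have heq : (r * q * D.coeff j) * (m : ℝ) ^ (j - 1) =
          r * (q * ((m : ℝ) ^ (j - 1) * (taylor (u m : ℝ) D).coeff j)) -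
          ∑ i ∈ Finset.Ioc j k,
            ((q * m ^ (j - 1) * i.choose j * u m ^ (i - j) : ℤ) : ℝ) * (r * D.coeff i) := by
        have : ∑ i ∈ Finset.Ioc j k,
            ((q * m ^ (j - 1) * i.choose j * u m ^ (i - j) : ℤ) : ℝ) * (r * D.coeff i) =
            r * q * (m : ℝ) ^ (j - 1) *
              ∑ i ∈ Finset.Ioc j k, (i.choose j : ℝ) * (u m : ℝ) ^ (i - j) * D.coeff i := by
          rw [Finset.mul_sum]; refine Finset.sum_congr rfl fun i _ => ?_
          push_cast; ring
        rw [this, ← hc]; ring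
      rw [heq]
      refine (distInt_sub_le _ _).trans ?_
      set Z := M ^ (j - 1) * (N / H ^ (j + 1)) with hZ
      have hZ0 : 0 ≤ Z := by positivity
      have hb1 : distInt (r * (q * ((m : ℝ) ^ (j - 1) * (taylor (u m : ℝ) D).coeff j))) ≤
          X ^ (A + e) * Z := by
        refine (distInt_nat_mul_le _ _).trans ?_
        rw [pow_add, mul_assoc]
        exact mul_le_mul hrA h1 (distInt_nonneg _) (by positivity)
      have hb2 : distInt (∑ i ∈ Finset.Ioc j k,
          ((q * m ^ (j - 1) * i.choose j * u m ^ (i - j) : ℤ) : ℝ) * (r * D.coeff i)) ≤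
          k * (X ^ (A + e + 2 * k) * Z) := by
        refine (distInt_sum_le _ _).trans ?_
        refine (Finset.sum_le_card_nsmul _ _ (X ^ (A + e + 2 * k) * Z) fun i hi => ?_).trans ?_
        · rw [Finset.mem_Ioc] at hi
          refine (distInt_int_mul_le _ _).trans ?_
          have h2 : |((q * m ^ (j - 1) * i.choose j * u m ^ (i - j) : ℤ) : ℝ)| ≤
              X ^ e * (X * M) ^ (j - 1) * X ^ k * H ^ (i - j) := by
            push_cast
            rw [abs_mul, abs_mul, abs_mul, abs_pow, abs_pow, Nat.abs_cast, Nat.abs_cast,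
              Nat.abs_cast]
            have hm2 : (m : ℝ) ≤ X * M := (hs2 m (hs's hm)).trans (by gcongr)
            have hu' := hu m (hs's hm)
            have hch : (i.choose j : ℝ) ≤ X ^ k := by
              calc (i.choose j : ℝ) ≤ (2 ^ i : ℕ) := by
                    exact_mod_cast Nat.choose_le_two_pow i j
                _ = 2 ^ i := by push_cast; rfl
                _ ≤ X ^ i := by gcongr
                _ ≤ X ^ k := hle hi.2
            gcongr
          have hHi : H ^ (i + 1) = H ^ (i - j) * H ^ (j + 1) := by
            rw [← pow_add]; congr 1; omega
          calc _ ≤ X ^ e * (X * M) ^ (j - 1) * X ^ k * H ^ (i - j) *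
                (X ^ A * (N / H ^ (i + 1))) :=
                mul_le_mul h2 (hr i (by omega) hi.2 (by omega)) (distInt_nonneg _) (by positivity)
            _ = X ^ (A + e + k + (j - 1)) * Z := by
                rw [hZ, hHi, mul_pow, pow_add, pow_add, pow_add]; field_simp; ring
            _ ≤ _ := by
                have := hle (show A + e + k + (j - 1) ≤ A + e + 2 * k by omega)
                gcongr
        · rw [nsmul_eq_mul, Nat.card_Ioc]
          gcongr
          omega
      have hk := natCast_le_pow hX (k + 1)
      push_cast at hk
      have h5 : X ^ (A + e) ≤ X ^ (A + e + 2 * k) := hle (by omega)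
      calc _ ≤ X ^ (A + e) * Z + k * (X ^ (A + e + 2 * k) * Z) := add_le_add hb1 hb2
        _ ≤ X ^ (A + e + 2 * k) * Z + k * (X ^ (A + e + 2 * k) * Z) := by gcongr
        _ = (k + 1) * (X ^ (A + e + 2 * k) * Z) := by ring
        _ ≤ X ^ (k + 1) * (X ^ (A + e + 2 * k) * Z) := by gcongr
        _ = ε := by rw [hε, hK]; ring
    have hεM : X ^ A₁ * ε / M ^ (j - 1) = X ^ (A₁ + K) * (N / H ^ (j + 1)) := by
      rw [hε, pow_add X A₁ K]; field_simp
    obtain ⟨t, ht1, htA, ht⟩ : ∃ t : ℕ, 1 ≤ t ∧ (t : ℝ) ≤ X ^ A₁ ∧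
        distInt (t * (r * q * D.coeff j)) ≤ X ^ (A₁ + K) * (N / H ^ (j + 1)) := by
      -- For `j = 1` the monomial is constant and a single `m` suffices; Vinogradov's lemma would
      -- say nothing about a constant term.
      rcases eq_or_ne j 1 with hj | hj
      · obtain ⟨m, hm⟩ : s'.Nonempty := by
          rw [← Finset.card_pos]; by_contra h0
          have : s'.card = 0 := by omega
          rw [this] at hMpos; simp at hMpos; linarith
        refine ⟨1, le_rfl, by simpa using one_le_pow₀ hX1, ?_⟩
        have h1 := hmain m hm
        rw [hε, hj] at h1
        simp only [Nat.sub_self, pow_zero, mul_one, one_mul] at h1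
        rw [hj, Nat.cast_one, one_mul]
        refine h1.trans ?_
        have := hle (show K ≤ A₁ + K by omega)
        gcongr
      · have hMA : X ^ A₁ ≤ M := by
          have h1 : X ^ A₁ * N ≤ M * N := by
            refine (hlem hN.le (by omega) hNH).trans ?_
            rw [mul_comm H M]; gcongr
          exact le_of_mul_le_mul_right h1 hN
        have hMleH : M ≤ H := by
          have := hlem hM.le (Nat.zero_le _) hMH
          simpa using this
        obtain ⟨t, ht1, htA, ht⟩ := hA₁ X M ε (C (r * q * D.coeff j) * Polynomial.X ^ (j - 1))
          (s'.image fun m : ℕ => (m : ℤ)) hX hMA (by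
            have h1 : M ^ (j - 1) * (N / H ^ (j + 1)) ≤ N / H ^ 2 := by
              have : H ^ (j + 1) = H ^ (j - 1) * H ^ 2 := by rw [← pow_add]; congr 1; omega
              rw [this]
              calc M ^ (j - 1) * (N / (H ^ (j - 1) * H ^ 2)) ≤
                  H ^ (j - 1) * (N / (H ^ (j - 1) * H ^ 2)) := by gcongr
                _ = N / H ^ 2 := by field_simp
            calc ε * X ^ A₁ ≤ X ^ K * (N / H ^ 2) * X ^ A₁ := by rw [hε]; gcongr
              _ = X ^ (A₁ + K) * N / H ^ 2 := by rw [pow_add]; ring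
              _ ≤ 1 := by
                rw [div_le_one (by positivity)]
                refine (hlem hN.le (by omega) hNH).trans ?_
                rw [sq]; gcongr)
          ((natDegree_C_mul_X_pow_le _ _).trans (by omega))
          (by
            intro x hx
            obtain ⟨m, hm, rfl⟩ := Finset.mem_image.1 hx
            rw [Int.cast_natCast, Nat.abs_cast]
            refine (hs2 m (hs's hm)).trans ?_
            have := hX.trans (le_self_pow₀ hX1 (show 2 * e + 1 ≠ 0 by omega))
            gcongr)
          (by
            rw [Finset.card_image_of_injective _ Nat.cast_injective]
            refine hMpos.trans ?_
            have := hle (show 2 * e ≤ 2 * e + 1 by omega)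
            gcongr)
          (by
            intro x hx
            obtain ⟨m, hm, rfl⟩ := Finset.mem_image.1 hx
            simpa using hmain m hm)
        refine ⟨t, ht1, htA, ?_⟩
        have h1 := ht (j - 1) (by omega)
        rwa [coeff_C_mul_X_pow, if_pos rfl, hεM] at h1
    refine ⟨t * q * r, Nat.mul_pos (Nat.mul_pos ht1 hq1) hr1, ?_, fun i hi1 hik hi => ?_⟩
    · push_cast
      calc (t : ℝ) * q * r ≤ X ^ A₁ * X ^ e * X ^ A := by gcongr
        _ = X ^ (A₁ + e + A) := by ring
        _ ≤ _ := hle (by omega)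
    · rcases eq_or_ne i j with rfl | hij
      · have : ((t * q * r : ℕ) : ℝ) * D.coeff i = t * (r * q * D.coeff i) := by push_cast; ring
        rw [this]
        exact ht.trans (hmono (by positivity) (by omega))
      · have : ((t * q * r : ℕ) : ℝ) * D.coeff i = ((t * q : ℕ) : ℝ) * (r * D.coeff i) := by
          push_cast; ring
        rw [this]
        refine (distInt_nat_mul_le _ _).trans ?_
        push_cast
        calc (t : ℝ) * q * distInt (r * D.coeff i) ≤
              X ^ A₁ * X ^ e * (X ^ A * (N / H ^ (i + 1))) :=
              mul_le_mul (by gcongr) (hr i hi1 hik (by omega)) (distInt_nonneg _) (by positivity)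
          _ = X ^ (A₁ + e + A) * (N / H ^ (i + 1)) := by ring
          _ ≤ _ := hmono (by positivity) (by omega)



end ShortIntervalTypeII

/-! ### Assembly -/

theorem proposition2p2 (k : ℕ) (hk : 1 ≤ k) :
    ∃ C K : ℝ, 0 < C ∧ 0 < K ∧
      ∀ (N : ℕ) (H δ M : ℝ) (a b : ℕ → ℂ) (α : ℕ → ℝ),
        2 ≤ N → H ≤ N →
        0 < δ → δ < 1 / 2 →
        2 ≤ M →
        δ ^ (-C) * max ((N : ℝ) / M) M ≤ H →
        (∀ l : ℕ, 1 ≤ l → ‖a l‖ ≤ ShortIntervalTypeII.tau 5 l) →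
        (∀ m : ℕ, 1 ≤ m → ‖b m‖ ≤ ShortIntervalTypeII.tau 3 m) →
        α (k + 1) = 0 →
        δ * H * Real.log N ^ 32 ≤
          ‖∑ p ∈ ShortIntervalTypeII.pairs N H M,
            a p.1 * b p.2 *
              ShortIntervalTypeII.e (ShortIntervalTypeII.g k N α ((p.1 : ℝ) * p.2))‖ →
        ∃ q : ℕ, 1 ≤ q ∧ (q : ℝ) ≤ δ ^ (-K) ∧
          ∀ j : ℕ, 1 ≤ j → j ≤ k →
            ShortIntervalTypeII.distInt (q * (j * α j + (j + 1) * N * α (j + 1))) ≤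
              δ ^ (-K) * (N / H ^ (j + 1)) := by
  obtain ⟨A₀, hA₀⟩ := ShortIntervalTypeII.exists_large_correlations
  obtain ⟨A₁, hA₁⟩ := ShortIntervalTypeII.taylor_eulerPoly_of_large_correlations k A₀
  -- The exponent `A₀ + A₁` covers both the density of the `m` and the local denominators. Treating
  -- the top `k` coefficients reaches every `j ≥ 1`.
  obtain ⟨A₂, hA₂⟩ := ShortIntervalTypeII.coeff_of_taylor_coeff_mul_pow k (A₀ + A₁) k
  set A := A₀ + A₁ + A₂ + 1
  have hA0 : (0 : ℝ) < (A : ℕ) := by positivity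
  refine ⟨(A : ℕ), (A : ℕ), hA0, hA0, ?_⟩
  intro N H δ M a b α hN hHN hδ hδ2 hM hH ha hb hα hsum
  set X := δ⁻¹ with hXdef
  have hX : 2 ≤ X := by
    rw [hXdef, le_inv_comm₀ (by norm_num) hδ]; linarith
  have hpow : δ ^ (-(A : ℝ)) = X ^ A := by
    rw [Real.rpow_neg hδ.le, Real.rpow_natCast, inv_pow]
  rw [hpow] at hH ⊢
  have hX1 : 1 ≤ X := by linarith
  have hX0 : 0 < X := by linarith
  have hle : ∀ {i j : ℕ}, i ≤ j → X ^ i ≤ X ^ j := fun h => pow_le_pow_right₀ hX1 h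
  have hM0 : 0 < M := by linarith
  have hN0 : (0 : ℝ) < N := by exact_mod_cast (by omega : 0 < N)
  have hMH : ∀ {i : ℕ}, i ≤ A → X ^ i * M ≤ H := fun hi =>
    le_trans (mul_le_mul (hle hi) (le_max_right _ _) hM0.le (by positivity)) hH
  have hNH : ∀ {i : ℕ}, i ≤ A → X ^ i * N ≤ H * M := fun {i} hi => by
    have h1 : X ^ i * (N / M) ≤ H :=
      le_trans (mul_le_mul (hle hi) (le_max_left _ _) (by positivity) (by positivity)) hH
    rw [← mul_div_assoc, div_le_iff₀ hM0] at h1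
    exact h1
  have hH0 : 0 < H := lt_of_lt_of_le (by positivity) (hMH (Nat.zero_le _))
  have hsum' : H * Real.log N ^ 32 ≤ X * ‖∑ p ∈ ShortIntervalTypeII.pairs N H M,
      a p.1 * b p.2 *
        ShortIntervalTypeII.e (ShortIntervalTypeII.g k N α ((p.1 : ℝ) * p.2))‖ := by
    calc H * Real.log N ^ 32 = X * (δ * H * Real.log N ^ 32) := by
          rw [hXdef]; field_simp
      _ ≤ _ := by gcongr
  obtain ⟨R, s, hs, hcorr⟩ := hA₀ X M H N (ShortIntervalTypeII.g k N α) a b hX hM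
    (by simpa using hMH (show 1 ≤ A by omega)) (by simpa using hNH (show 1 ≤ A by omega))
    hHN ha hb hsum'
  have hloc : ∀ m ∈ s, ∃ u : ℤ, |(u : ℝ)| ≤ H ∧ ∀ j, 1 ≤ j → j ≤ k →
      ∃ q : ℕ, 1 ≤ q ∧ (q : ℝ) ≤ X ^ A₁ ∧ ShortIntervalTypeII.distInt (q * ((m : ℝ) ^ (j - 1) *
        (Polynomial.taylor (u : ℝ) (ShortIntervalTypeII.eulerPoly N
          (ShortIntervalTypeII.gPoly k α))).coeff j)) ≤
        X ^ A₁ * ((M / H) ^ j * (N / (H * M))) := by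
    intro m hm
    obtain ⟨hm12, s', hs', hcorr'⟩ := hcorr m hm
    exact hA₁ X H M N R α m s' hX hM0 (hMH (by omega)) (hNH (by omega)) hN0 hm12.1 hm12.2 hs'
      fun m' hm' => (hcorr' m' hm').2
  choose! u hu hq using hloc
  obtain ⟨q, hq1, hqA, hq⟩ := hA₂ X H M N _ s u hX hM0 hN0 (hMH (by omega)) (hNH (by omega)) hHN
    (ShortIntervalTypeII.natDegree_eulerPoly_le
      (ShortIntervalTypeII.natDegree_gPoly_le k α) hk)
    (hs.trans (by
      have := hle (show A₀ ≤ A₀ + A₁ by omega)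
      gcongr))
    (fun m hm => (hcorr m hm).1.2) hu
    (fun m hm j hj hjk => by
      obtain ⟨q, h1, h2, h3⟩ := hq m hm j hj hjk
      have := hle (show A₁ ≤ A₀ + A₁ by omega)
      exact ⟨q, h1, h2.trans this, h3.trans (by gcongr)⟩)
  refine ⟨q, hq1, hqA.trans (hle (by omega)), fun j hj hjk => ?_⟩
  -- The case `i = k + 1` is where `α (k + 1) = 0` enters.
  have hcoeff : ∀ i, 1 ≤ i → i ≤ k + 1 → (ShortIntervalTypeII.gPoly k α).coeff i = α i := by
    intro i h1 h2
    rw [ShortIntervalTypeII.coeff_gPoly]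
    split_ifs with h
    · rfl
    · have : i = k + 1 := by rw [Finset.mem_Icc] at h; omega
      rw [this, hα]
  have h1 := hq j hj hjk (by omega)
  rw [ShortIntervalTypeII.coeff_eulerPoly _ _ hj, hcoeff j hj (by omega),
    hcoeff (j + 1) (by omega) (by omega)] at h1
  refine h1.trans ?_
  have := hle (show A₂ ≤ A by omega)
  gcongr
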